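/- Consider the plant $\dot x = Ax+B_uu+B_ww$, $z = C_zx+D_uu+D_ww$, $y = C_yx+D_{yw}w$ with real matrices, $x\in\mathbb R^{N_x}$, $u\in\mathbb R^{N_u}$, $w\in\mathbb R^{N_w}$, $z\in\mathbb R^{N_z}$, $y\in\mathbb R^{N_y}$, and full-order controllers $\dot x_K=A_Kx_K+B_Ky$, $u=C_Kx_K+D_Ky$, $x_K\in\mathbb R^{N_x}$. The closed loop from $w$ to $z$ has matrices $$A_{cl}=\begin{bmatrix}A+B_uD_KC_y&B_uC_K\\B_KC_y&A_K\end{bmatrix},\quad B_{cl}=\begin{bmatrix}B_w+B_uD_KD_{yw}\\B_KD_{yw}\end{bmatrix},\quad C_{cl}=\begin{bmatrix}C_z+D_uD_KC_y&D_uC_K\end{bmatrix},\quad D_{cl}=D_w+D_uD_KD_{yw},$$ and transfer function $\mathcal G_{cl}(s)=C_{cl}(sI-A_{cl})^{-1}B_{cl}+D_{cl}$. Fix $\gamma_0>0$ and weights $\mu\in\mathbb R^{N_u}$, $\nu\in\mathbb R^{N_y}$ with nonnegative entries. A controller meets the specification if $A_{cl}$ is Hurwitz and $\|\mathcal G_{cl}\|_{\mathcal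 H_\infty}<\gamma_0$. A performance Lyapunov matrix of the closed loop is a symmetric $X_{cl}\succ0$ such that $$2x^\top X_{cl}(A_{cl}x+B_{cl}w)+\gamma_0^{-1}|C_{cl}x+D_{cl}w|^2-\gamma_0|w|^2<0\quad\text{for all }(x,w)\ne0.$$ Write $X_{cl}=\begin{bmatrix}Y&N\\N^\top&\star\end{bmatrix}$ and $X_{cl}^{-1}=\begin{bmatrix}X&M\\M^\top&\star\end{bmatrix}$ with $N_x\times N_x$ blocks $X,Y,M,N$, and let $\hat J=(\hat A_K,\hat B_K,\hat C_K,\hat D_K)$ be given by $$\begin{aligned}\hat A_K&=NA_KM^\top+NB_KC_yX+YB_uC_KM^\top+Y(A+B_uD_KC_y)X,\\ \hat B_K&=NB_K+YB_uD_K,\qquad \hat C_K=C_KM^\top+D_KC_yX,\qquad \hat D_K=D_K.\end{aligned}\tag{1}$$ Let $\bar c_i^\top$ be the rows of $[\hat C_K\ \hat D_K]$ and $\bar b_i$ the columns of $\begin{bmatrix}\hat B_K\\\hat D_K\end{bmatrix}$, and put $f(\hat J)=\sum_{i=1}^{N_u}\mu_i\|\bar c_i\|_2+\sum_{i=1}^{N_y}\nu_i\|\bar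 b_i\|_2$. Design problem: minimize $f(\hat J)$ over all $\hat J$ that are obtained by (1) from a controller meeting the specification and a performance Lyapunov matrix $X_{cl}$ of its closed loop with $M,N$ nonsingular. LMI problem: minimize $f(\hat J)$ over $\hat J$ and $X,Y\in\mathbb R^{N_x\times N_x}$ subject to $\begin{bmatrix}X&I\\I&Y\end{bmatrix}\succ0$ and, with $\operatorname{sym}(Q)=Q+Q^\top$ and $\ast$ denoting the blocks determined by symmetry, $$\begin{bmatrix} \operatorname{sym}(AX+B_u\hat C_K)&\ast&\ast&\ast\\ \hat A_K+(A+B_u\hat D_KC_y)^\top&\operatorname{sym}(YA+\hat B_KC_y)&\ast&\ast\\ (B_w+B_u\hat D_KD_{yw})^\top&(YB_w+\hat B_KD_{yw})^\top&-\gamma_0I&\ast\\ C_zX+D_u\hat C_K&C_z+D_u\hat D_KC_y&D_w+D_u\hat D_KD_{yw}&-\gamma_0I \end{bmatrix}\prec0 .$$ Then the design problem is solved by the LMI problem, in the following sense. (a) A controller meets the specification if and only if there is a symmetric $X_{cl}\succ0$ with $M,N$ nonsingular such that $X$, $Y$ and the $\hat J$ given by (1) satisfy the constraints of the LMI problem.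 (b) $(\hat J,X,Y)$ satisfies the constraints of the LMI problem if and only if $\hat J$ is obtained by (1) from a controller meeting the specification and a performance Lyapunov matrix $X_{cl}$ of its closed loop that has $M,N$ nonsingular and blocks $X,Y$. (c) If $(\hat J,X,Y)$ satisfies the constraints of the LMI problem, then $I-XY$ is nonsingular, and for every factorization $MN^\top=I-XY$ with $M,N\in\mathbb R^{N_x\times N_x}$ the controller $$\begin{aligned}D_K&=\hat D_K,\qquad C_K=(\hat C_K-D_KC_yX)M^{-\top},\qquad B_K=N^{-1}(\hat B_K-YB_uD_K),\\ A_K&=N^{-1}\big[\hat A_K-NB_KC_yX-YB_uC_KM^\top-Y(A+B_uD_KC_y)X\big]M^{-\top}\end{aligned}$$ meets the specification, and $\hat J$ is obtained by (1) from it and a performance Lyapunov matrix of its closed loop with blocks $X,Y,M,N$. (d) The two problems have the same optimal value (infimum, $+\infty$ if there is no feasible point), and $\hat J$ is an optimal solution of the design problem if and only if $(\hat J,X,Y)$ is an optimal solution of the LMI problem for some $X,Y$. -/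

import Mathlib

open Matrix

noncomputable section

/-- Data of the linear time-invariant plant (with no feed-through from `u` to `y`)
`x' = A x + Bu u + Bw w`, `z = Cz x + Du u + Dw w`, `y = Cy x + Dyw w`. -/
structure Plant (nx nu nw nz ny : ℕ) where
  A : Matrix (Fin nx) (Fin nx) ℝ
  Bu : Matrix (Fin nx) (Fin nu) ℝ
  Bw : Matrix (Fin nx) (Fin nw) ℝ
  Cz : Matrix (Fin nz) (Fin nx) ℝ
  Du : Matrix (Fin nz) (Fin nu) ℝ
  Dw : Matrix (Fin nz) (Fin nw) ℝ
  Cy : Matrix (Fin ny) (Fin nx) ℝ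
  Dyw : Matrix (Fin ny) (Fin nw) ℝ

/-- Dynamic output-feedback controller with `nk` states:
`xK' = AK xK + BK y`, `u = CK xK + DK y`. -/
@[ext]
structure Controller (nk nu ny : ℕ) where
  AK : Matrix (Fin nk) (Fin nk) ℝ
  BK : Matrix (Fin nk) (Fin ny) ℝ
  CK : Matrix (Fin nu) (Fin nk) ℝ
  DK : Matrix (Fin nu) (Fin ny) ℝ

/-- The transformed controller variables `Ĵ = (ÂK, B̂K, ĈK, D̂K)`. -/
@[ext]
structure HatVars (nx nu ny : ℕ) where
  Ah : Matrix (Fin nx) (Fin nx) ℝ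
  Bh : Matrix (Fin nx) (Fin ny) ℝ
  Ch : Matrix (Fin nu) (Fin nx) ℝ
  Dh : Matrix (Fin nu) (Fin ny) ℝ

/-- `M < 0` for a real symmetric matrix `M`. -/
def NegDef {n : Type*} [Fintype n] (M : Matrix n n ℝ) : Prop := (-M).PosDef

/-- `sym M = M + Mᵀ`. -/
def symPart {n : Type*} (M : Matrix n n ℝ) : Matrix n n ℝ := M + Mᵀ

section ClosedLoop

variable {nx nu nw nz ny nk : ℕ}

def closedA (P : Plant nx nu nw nz ny) (K : Controller nk nu ny) :
    Matrix (Fin nx ⊕ Fin nk) (Fin nx ⊕ Fin nk) ℝ :=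
  fromBlocks (P.A + P.Bu * K.DK * P.Cy) (P.Bu * K.CK) (K.BK * P.Cy) K.AK

def closedB (P : Plant nx nu nw nz ny) (K : Controller nk nu ny) :
    Matrix (Fin nx ⊕ Fin nk) (Fin nw) ℝ :=
  fromRows (P.Bw + P.Bu * K.DK * P.Dyw) (K.BK * P.Dyw)

def closedC (P : Plant nx nu nw nz ny) (K : Controller nk nu ny) :
    Matrix (Fin nz) (Fin nx ⊕ Fin nk) ℝ :=
  fromCols (P.Cz + P.Du * K.DK * P.Cy) (P.Du * K.CK)

def closedD (P : Plant nx nu nw nz ny) (K : Controller nk nu ny) :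
    Matrix (Fin nz) (Fin nw) ℝ :=
  P.Dw + P.Du * K.DK * P.Dyw

end ClosedLoop

/-- Every eigenvalue of the real matrix `A` has negative real part. -/
def IsHurwitz {n : Type*} [Fintype n] [DecidableEq n] (A : Matrix n n ℝ) : Prop :=
  ∀ s ∈ spectrum ℂ (A.map Complex.ofReal), s.re < 0

/-- The transfer function `G(s) = C (s I - A)⁻¹ B + D`. -/
def transferFunction {n p q : Type*} [Fintype n] [DecidableEq n]
    (A : Matrix n n ℝ) (B : Matrix n q ℝ) (C : Matrix p n ℝ) (D : Matrix p q ℝ) (s : ℂ) :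
    Matrix p q ℂ :=
  C.map Complex.ofReal * (s • (1 : Matrix n n ℂ) - A.map Complex.ofReal)⁻¹ * B.map Complex.ofReal
    + D.map Complex.ofReal

/-- The `H∞` norm: supremum over the open right half-plane of the largest singular value
(the operator norm with respect to Euclidean norms), as an extended nonnegative real. -/
def hinfNorm {p q : Type*} [Fintype p] [Fintype q] [DecidableEq q]
    (G : ℂ → Matrix p q ℂ) : ENNReal :=
  ⨆ (s : ℂ) (_ : 0 < s.re),
    ENNReal.ofReal ‖LinearMap.toContinuousLinearMap (Matrix.toEuclideanLin (G s))‖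

section Design

variable {nx nu nw nz ny nk : ℕ}

/-- The closed-loop transfer function from `w` to `z`. -/
def closedLoopTF (P : Plant nx nu nw nz ny) (K : Controller nk nu ny) :
    ℂ → Matrix (Fin nz) (Fin nw) ℂ :=
  transferFunction (closedA P K) (closedB P K) (closedC P K) (closedD P K)

/-- The performance specification: the closed loop is internally stable and its `H∞` norm from
`w` to `z` is smaller than `γ`. -/
def MeetsSpec (P : Plant nx nu nw nz ny) (γ : ℝ) (K : Controller nk nu ny) : Prop :=
  IsHurwitz (closedA P K) ∧ hinfNorm (closedLoopTF P K) < ENNReal.ofReal γ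

/-- `Xcl` is a Lyapunov matrix of the closed loop for the performance level `γ`: it is symmetric
positive definite and `V(x) = xᵀ Xcl x` satisfies `V' + γ⁻¹ |z|² - γ |w|² < 0` along the closed
loop, whenever `(x, w) ≠ 0`. -/
def IsPerfLyapunov (P : Plant nx nu nw nz ny) (γ : ℝ) (K : Controller nk nu ny)
    (Xcl : Matrix (Fin nx ⊕ Fin nk) (Fin nx ⊕ Fin nk) ℝ) : Prop :=
  Xcl.PosDef ∧
    ∀ (x : Fin nx ⊕ Fin nk → ℝ) (w : Fin nw → ℝ), (x ≠ 0 ∨ w ≠ 0) →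
      2 * (x ⬝ᵥ (Xcl *ᵥ (closedA P K *ᵥ x + closedB P K *ᵥ w)))
        + γ⁻¹ * ((closedC P K *ᵥ x + closedD P K *ᵥ w) ⬝ᵥ
            (closedC P K *ᵥ x + closedD P K *ᵥ w))
        - γ * (w ⬝ᵥ w) < 0

/-- The blocks of `Xcl = [Y N; Nᵀ ⋆]` and `Xcl⁻¹ = [X M; Mᵀ ⋆]`. -/
def blockY (Xcl : Matrix (Fin nx ⊕ Fin nx) (Fin nx ⊕ Fin nx) ℝ) : Matrix (Fin nx) (Fin nx) ℝ :=
  Xcl.toBlocks₁₁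

def blockN (Xcl : Matrix (Fin nx ⊕ Fin nx) (Fin nx ⊕ Fin nx) ℝ) : Matrix (Fin nx) (Fin nx) ℝ :=
  Xcl.toBlocks₁₂

def blockX (Xcl : Matrix (Fin nx ⊕ Fin nx) (Fin nx ⊕ Fin nx) ℝ) : Matrix (Fin nx) (Fin nx) ℝ :=
  Xcl⁻¹.toBlocks₁₁

def blockM (Xcl : Matrix (Fin nx ⊕ Fin nx) (Fin nx ⊕ Fin nx) ℝ) : Matrix (Fin nx) (Fin nx) ℝ :=
  Xcl⁻¹.toBlocks₁₂

/-- The change of variables from a full-order controller to `Ĵ`. -/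
def changeVars (P : Plant nx nu nw nz ny) (K : Controller nx nu ny)
    (X Y M N : Matrix (Fin nx) (Fin nx) ℝ) : HatVars nx nu ny where
  Ah := N * K.AK * Mᵀ + N * K.BK * P.Cy * X + Y * P.Bu * K.CK * Mᵀ
    + Y * (P.A + P.Bu * K.DK * P.Cy) * X
  Bh := N * K.BK + Y * P.Bu * K.DK
  Ch := K.CK * Mᵀ + K.DK * P.Cy * X
  Dh := K.DK

/-- The change of variables with the blocks of a matrix `Xcl` and of its inverse. -/
def hatOf (P : Plant nx nu nw nz ny) (K : Controller nx nu ny)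
    (Xcl : Matrix (Fin nx ⊕ Fin nx) (Fin nx ⊕ Fin nx) ℝ) : HatVars nx nu ny :=
  changeVars P K (blockX Xcl) (blockY Xcl) (blockM Xcl) (blockN Xcl)

/-- The controller constructed from `Ĵ`, `X`, `Y` and (nonsingular) `M`, `N`. -/
def constructController (P : Plant nx nu nw nz ny) (J : HatVars nx nu ny)
    (X Y M N : Matrix (Fin nx) (Fin nx) ℝ) : Controller nx nu ny :=
  let DK := J.Dh
  let CK := (J.Ch - DK * P.Cy * X) * (Mᵀ)⁻¹
  let BK := N⁻¹ * (J.Bh - Y * P.Bu * DK)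
  { AK := N⁻¹ * (J.Ah - N * BK * P.Cy * X - Y * P.Bu * CK * Mᵀ
      - Y * (P.A + P.Bu * DK * P.Cy) * X) * (Mᵀ)⁻¹
    BK := BK
    CK := CK
    DK := DK }

/-- `Ĵ` represents the full-order controller `K`, which meets the specification, through the
Lyapunov matrix `Xcl` (with nonsingular off-diagonal blocks `M`, `N`). -/
def IsRepresentation (P : Plant nx nu nw nz ny) (γ : ℝ) (K : Controller nx nu ny)
    (Xcl : Matrix (Fin nx ⊕ Fin nx) (Fin nx ⊕ Fin nx) ℝ) (J : HatVars nx nu ny) : Prop :=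
  MeetsSpec P γ K ∧ IsPerfLyapunov P γ K Xcl ∧
    IsUnit (blockM Xcl) ∧ IsUnit (blockN Xcl) ∧ J = hatOf P K Xcl

/-- Feasible set of the sparse sensing and actuation design problem. -/
def designFeasible (P : Plant nx nu nw nz ny) (γ : ℝ) : Set (HatVars nx nu ny) :=
  {J | ∃ K Xcl, IsRepresentation P γ K Xcl J}

/-- The matrix of the `H∞` output-feedback linear matrix inequality. -/
def hinfLMI (P : Plant nx nu nw nz ny) (γ : ℝ) (J : HatVars nx nu ny)
    (X Y : Matrix (Fin nx) (Fin nx) ℝ) :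
    Matrix ((Fin nx ⊕ Fin nx) ⊕ (Fin nw ⊕ Fin nz)) ((Fin nx ⊕ Fin nx) ⊕ (Fin nw ⊕ Fin nz)) ℝ :=
  let L21 := J.Ah + (P.A + P.Bu * J.Dh * P.Cy)ᵀ
  let L31 := (P.Bw + P.Bu * J.Dh * P.Dyw)ᵀ
  let L32 := (Y * P.Bw + J.Bh * P.Dyw)ᵀ
  let L41 := P.Cz * X + P.Du * J.Ch
  let L42 := P.Cz + P.Du * J.Dh * P.Cy
  let L43 := P.Dw + P.Du * J.Dh * P.Dyw
  fromBlocks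
    (fromBlocks (symPart (P.A * X + P.Bu * J.Ch)) L21ᵀ L21 (symPart (Y * P.A + J.Bh * P.Cy)))
    (fromBlocks L31ᵀ L41ᵀ L32ᵀ L42ᵀ)
    (fromBlocks L31 L32 L41 L42)
    (fromBlocks (-(γ • (1 : Matrix (Fin nw) (Fin nw) ℝ))) L43ᵀ L43
      (-(γ • (1 : Matrix (Fin nz) (Fin nz) ℝ))))

/-- Feasible set of the LMI program: `[X I; I Y] > 0` and the `H∞` output-feedback LMI. -/
def lmiFeasible (P : Plant nx nu nw nz ny) (γ : ℝ) :
    Set (HatVars nx nu ny × Matrix (Fin nx) (Fin nx) ℝ × Matrix (Fin nx) (Fin nx) ℝ) :=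
  {t | (fromBlocks t.2.1 1 1 t.2.2).PosDef ∧ NegDef (hinfLMI P γ t.1 t.2.1 t.2.2)}

/-- The weighted sum of the Euclidean norms of the rows of `[ĈK D̂K]` and of the columns of
`[B̂K; D̂K]`. -/
def sparsityCost (μ : Fin nu → ℝ) (ν : Fin ny → ℝ) (J : HatVars nx nu ny) : ℝ :=
  ∑ i, μ i * ‖WithLp.toLp 2 ((fromCols J.Ch J.Dh).row i)‖
    + ∑ i, ν i * ‖WithLp.toLp 2 ((fromRows J.Bh J.Dh).col i)‖

end Design

/-- Optimal value of `min f` over `S` (`⊤` when `S` is empty). -/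
def optValue {α : Type*} (f : α → ℝ) (S : Set α) : EReal := ⨅ a ∈ S, (f a : EReal)

/-- `a` is an optimal solution of `min f` over `S`. -/
def IsOptimal {α : Type*} (f : α → ℝ) (S : Set α) (a : α) : Prop := a ∈ S ∧ ∀ b ∈ S, f a ≤ f b

end

/-! The theorem combines the bounded real lemma with a congruence that makes the bounded real
inequality affine in the transformed variables.

Bounded real lemma (`meetsSpec_iff_exists_isPerfLyapunov`): a controller meets the specification iff
its closed loop has a performance Lyapunov matrix. From Lyapunov matrix to specification, the
dissipation inequality is evaluated at complex `x`, `w` with `s x = A x + B w`, `Re s ≥ 0`. For the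
converse, if no symmetric `X` solves the inequality, Hahn-Banach separation yields a positive
semidefinite dual matrix; a unitary change of its rank-one decomposition splits it into pure
frequencies, one of which violates the frequency-domain bound (`exists_perfForm_neg_of_frequency`).
The solution `X` is positive definite by Lyapunov's theorem (`posDef_of_isHurwitz`).

Congruence (`hinfLMI_changeVars`): put `T = [X I; Mᵀ 0]` and `S = [I Y; 0 Nᵀ]`. The first block
column of `Xcl Xcl⁻¹ = I` gives `Xcl T = S`. Hence `Tᵀ Xcl T = [X I; I Y]`, and `diag(T, I)` carries
the bounded real matrix to the LMI matrix written in `Ĵ`. For nonsingular `M` this preserves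
definiteness.

Inversion: when `M Nᵀ = I - X Y` is nonsingular, `Xcl = S T⁻¹` has the prescribed blocks
(`exists_posDef_of_blocks`) and the change of variables can be solved for the controller
(`changeVars_constructController`). Nonsingularity of `M`, `N` costs nothing, because a performance
Lyapunov matrix survives small perturbations. So the design problem has as feasible set the
projection of the LMI feasible set, and the cost depends on `Ĵ` only. -/

/-- The quadratic form of the (not necessarily symmetric) real matrix `S` is negative definite. -/
def IsNegForm {ι : Type*} [Fintype ι] (S : Matrix ι ι ℝ) : Prop :=
  ∀ v : ι → ℝ, v ≠ 0 → v ⬝ᵥ (S *ᵥ v) < 0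

/-! ### Negative definite forms and a theorem of alternatives -/

section NegForm

variable {ι : Type*} [Fintype ι]

/-- Negativity on the compact unit sphere is stable, and homogeneity extends it to all nonzero
vectors. Since `IsNegForm` does not require symmetry, the set is open in the whole matrix space, as
the separation argument needs. -/
lemma isOpen_isNegForm : IsOpen {S : Matrix ι ι ℝ | IsNegForm S} := by
  rw [isOpen_iff_mem_nhds]
  intro S hS
  have hK : IsCompact (Metric.sphere (0 : ι → ℝ) 1) := isCompact_sphere _ _
  have key : ∀ᶠ S' in nhds S, ∀ v ∈ Metric.sphere (0 : ι → ℝ) 1, v ⬝ᵥ (S' *ᵥ v) < 0 := by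
    refine hK.eventually_forall_of_forall_eventually fun v hv => ?_
    have hc : Continuous fun z : Matrix ι ι ℝ × (ι → ℝ) => z.2 ⬝ᵥ (z.1 *ᵥ z.2) :=
      continuous_snd.dotProduct (continuous_fst.matrix_mulVec continuous_snd)
    refine hc.continuousAt.eventually_lt continuousAt_const (hS v ?_)
    rintro rfl
    simp at hv
  filter_upwards [key] with S' hS' v hv
  have hn : 0 < ‖v‖ := norm_pos_iff.mpr hv
  have h1 := hS' (‖v‖⁻¹ • v) (by simp [norm_smul, hn.ne'])
  rw [mulVec_smul, smul_dotProduct, dotProduct_smul, smul_smul, smul_eq_mul] at h1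
  have : 0 < ‖v‖⁻¹ * ‖v‖⁻¹ := by positivity
  exact (pos_iff_neg_of_mul_neg h1).mp this

lemma convex_isNegForm : Convex ℝ {S : Matrix ι ι ℝ | IsNegForm S} := by
  intro S hS T hT a b ha hb hab v hv
  have h1 := hS v hv
  have h2 := hT v hv
  rw [add_mulVec, smul_mulVec, smul_mulVec, dotProduct_add, dotProduct_smul, dotProduct_smul,
    smul_eq_mul, smul_eq_mul]
  rcases ha.eq_or_lt with rfl | ha
  · obtain rfl : b = 1 := by linarith
    simpa using h2
  · nlinarith [mul_neg_of_pos_of_neg ha h1, mul_nonpos_of_nonneg_of_nonpos hb h2.le]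

lemma IsNegForm.exists_add_smul_one [DecidableEq ι] {S : Matrix ι ι ℝ} (hS : IsNegForm S) :
    ∃ ε : ℝ, 0 < ε ∧ IsNegForm (S + ε • (1 : Matrix ι ι ℝ)) := by
  have hc : Continuous fun ε : ℝ => S + ε • (1 : Matrix ι ι ℝ) := by fun_prop
  have h0 : {S : Matrix ι ι ℝ | IsNegForm S} ∈ nhds (S + (0 : ℝ) • (1 : Matrix ι ι ℝ)) :=
    isOpen_isNegForm.mem_nhds (by simpa using hS)
  have := hc.continuousAt.preimage_mem_nhds h0
  obtain ⟨δ, hδ, h⟩ := Metric.mem_nhds_iff.mp this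
  exact ⟨δ / 2, by positivity, h (by simp [abs_of_pos hδ, hδ])⟩

lemma dotProduct_mulVec_eq_sum (S : Matrix ι ι ℝ) (v : ι → ℝ) :
    v ⬝ᵥ (S *ᵥ v) = ∑ i, ∑ j, S i j * (v i * v j) := by
  simp only [dotProduct, mulVec, Finset.mul_sum]
  exact Finset.sum_congr rfl fun i _ => Finset.sum_congr rfl fun j _ => by ring

open scoped MatrixOrder in
/-- A linear functional that is nonpositive on negative definite forms is, on symmetric matrices,
a sum of evaluations of the quadratic form. -/
lemma exists_eq_sum_dotProduct_mulVec [DecidableEq ι] (f : Matrix ι ι ℝ →ₗ[ℝ] ℝ)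
    (hf : ∀ v : ι → ℝ, 0 ≤ f (vecMulVec v v)) :
    ∃ r : ι → ι → ℝ, ∀ S : Matrix ι ι ℝ, S.IsSymm → f S = ∑ k, r k ⬝ᵥ (S *ᵥ r k) := by
  -- `Z` represents `f` in the entrywise pairing. Averaging with the transpose changes nothing on
  -- symmetric matrices and makes `Z` symmetric, so `hf` makes it positive semidefinite; the `r k`
  -- are the rows of `R` in `Z = Rᵀ R`.
  set Z : Matrix ι ι ℝ := of fun i j => (f (single i j 1) + f (single j i 1)) / 2 with hZ
  have hfS : ∀ S : Matrix ι ι ℝ, f S = ∑ i, ∑ j, S i j * f (single i j 1) := by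
    intro S
    conv_lhs => rw [matrix_eq_sum_single S]
    simp only [map_sum]
    refine Finset.sum_congr rfl fun i _ => Finset.sum_congr rfl fun j _ => ?_
    rw [← smul_eq_mul, ← map_smul, smul_single, smul_eq_mul, mul_one]
  have hfZ : ∀ S : Matrix ι ι ℝ, S.IsSymm → f S = ∑ i, ∑ j, S i j * Z i j := by
    intro S hS
    have h2 : ∑ i, ∑ j, S i j * f (single j i 1) = ∑ i, ∑ j, S i j * f (single i j 1) := by
      rw [Finset.sum_comm]
      refine Finset.sum_congr rfl fun i _ => Finset.sum_congr rfl fun j _ => ?_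
      rw [hS.apply i j]
    have h3 : ∑ i, ∑ j, S i j * Z i j = (∑ i, ∑ j, S i j * f (single i j 1)
        + ∑ i, ∑ j, S i j * f (single j i 1)) / 2 := by
      rw [← Finset.sum_add_distrib, Finset.sum_div]
      refine Finset.sum_congr rfl fun i _ => ?_
      rw [← Finset.sum_add_distrib, Finset.sum_div]
      refine Finset.sum_congr rfl fun j _ => ?_
      simp only [hZ, of_apply]
      ring
    rw [h3, h2, hfS]
    ring
  have hpsd : Z.PosSemidef := by
    refine PosSemidef.of_dotProduct_mulVec_nonneg ?_ fun v => ?_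
    · ext i j
      simp [hZ, add_comm]
    · have := hf v
      rw [hfZ _ (by ext i j; simp [vecMulVec_apply, mul_comm])] at this
      simp only [star_trivial]
      rw [dotProduct_mulVec_eq_sum]
      refine this.trans_eq (Finset.sum_congr rfl fun i _ => Finset.sum_congr rfl fun j _ => ?_)
      rw [vecMulVec_apply, mul_comm]
  obtain ⟨R, hR⟩ := CStarAlgebra.nonneg_iff_eq_star_mul_self.mp hpsd.nonneg
  refine ⟨fun k => R k, fun S hS => ?_⟩
  rw [hfZ S hS]
  simp only [dotProduct_mulVec_eq_sum]
  conv_rhs => rw [Finset.sum_comm]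
  refine Finset.sum_congr rfl fun i _ => ?_
  conv_rhs => rw [Finset.sum_comm]
  refine Finset.sum_congr rfl fun j _ => ?_
  rw [← Finset.mul_sum, hR]
  simp [mul_apply, star_eq_conjTranspose]

/-- Theorem of alternatives for an affine family of symmetric matrices. -/
theorem exists_isNegForm_or_exists_dual [DecidableEq ι] {E : Type*} [AddCommGroup E] [Module ℝ E]
    (S₀ : Matrix ι ι ℝ) (hS₀ : S₀.IsSymm) (L : E →ₗ[ℝ] Matrix ι ι ℝ) (hL : ∀ X, (L X).IsSymm) :
    (∃ X, IsNegForm (S₀ + L X)) ∨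
      ∃ r : ι → ι → ℝ, r ≠ 0 ∧ (∀ X, ∑ k, r k ⬝ᵥ (L X *ᵥ r k) = 0) ∧
        0 ≤ ∑ k, r k ⬝ᵥ (S₀ *ᵥ r k) := by
  by_cases hX : ∃ X, IsNegForm (S₀ + L X)
  · exact Or.inl hX
  right
  push Not at hX
  have hconv : Convex ℝ (Set.range fun X => S₀ + L X) := by
    rintro _ ⟨X, rfl⟩ _ ⟨Y, rfl⟩ a b ha hb hab
    refine ⟨a • X + b • Y, ?_⟩
    obtain rfl : b = 1 - a := by linarith
    simp only [map_add, map_smul]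
    module
  -- The open convex cone of negative forms is separated from the affine family. Scaling in the cone
  -- gives `f ≤ 0` there, and letting forms in the cone tend to `0` gives `u ≥ 0`.
  obtain ⟨f, u, hs, ht⟩ := geometric_hahn_banach_open convex_isNegForm isOpen_isNegForm hconv
    (Set.disjoint_left.mpr (by rintro _ h ⟨X, rfl⟩; exact hX X h))
  have hcone : ∀ S : Matrix ι ι ℝ, IsNegForm S → f S ≤ 0 := by
    intro S hS
    by_contra! hpos
    have h1 : 0 < (|u| + 1) / f S := by positivity
    have h2 : IsNegForm (((|u| + 1) / f S) • S) := fun v hv => by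
      rw [smul_mulVec, dotProduct_smul, smul_eq_mul]
      exact mul_neg_of_pos_of_neg h1 (hS v hv)
    have h3 := hs _ h2
    rw [map_smul, smul_eq_mul, div_mul_cancel₀ _ hpos.ne'] at h3
    linarith [le_abs_self u]
  have hscal : ∀ ε : ℝ, 0 < ε → IsNegForm ((-ε) • (1 : Matrix ι ι ℝ)) := fun ε hε v hv => by
    rw [smul_mulVec, one_mulVec, dotProduct_smul, smul_eq_mul]
    have : 0 < v ⬝ᵥ v := by
      have := dotProduct_star_self_pos_iff.mpr hv
      simpa using this
    nlinarith
  have hu : 0 ≤ u := by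
    by_contra! hu
    rcases le_or_gt 0 (f 1) with h1 | h1
    · have h2 := hs _ (hscal ((-u) / (f 1 + 1)) (div_pos (by linarith) (by linarith)))
      rw [map_smul, smul_eq_mul, neg_mul, div_mul_eq_mul_div, neg_lt,
        lt_div_iff₀ (by linarith)] at h2
      nlinarith
    · have h2 := hcone _ (hscal 1 one_pos)
      rw [map_smul, smul_eq_mul] at h2
      linarith
  have hv : ∀ v : ι → ℝ, 0 ≤ f (vecMulVec v v) := by
    intro v
    -- `-v vᵀ` is only semidefinite; subtracting `ε • 1` puts it in the cone, and then `ε → 0`.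
    have h1 : ∀ ε : ℝ, 0 < ε → 0 ≤ f (vecMulVec v v) + ε * f 1 := fun ε hε => by
      have h2 : IsNegForm (-vecMulVec v v + (-ε) • (1 : Matrix ι ι ℝ)) := fun w hw => by
        rw [add_mulVec, dotProduct_add, neg_mulVec, dotProduct_neg, vecMulVec_mulVec]
        have := hscal ε hε w hw
        have h3 : 0 ≤ w ⬝ᵥ (MulOpposite.op (v ⬝ᵥ w) • v) := by
          rw [op_smul_eq_smul, dotProduct_smul, smul_eq_mul, dotProduct_comm w v]
          exact mul_self_nonneg _
        linarith
      have h3 := hcone _ h2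
      rw [map_add, map_neg, map_smul, smul_eq_mul] at h3
      linarith
    have hc : Filter.Tendsto (fun ε : ℝ => f (vecMulVec v v) + ε * f 1) (nhdsWithin 0 (Set.Ioi 0))
        (nhds (f (vecMulVec v v) + 0 * f 1)) :=
      ((Continuous.tendsto (by fun_prop) 0).mono_left nhdsWithin_le_nhds)
    rw [zero_mul, add_zero] at hc
    exact ge_of_tendsto hc (by filter_upwards [self_mem_nhdsWithin] with ε hε using h1 ε hε)
  obtain ⟨r, hr⟩ := exists_eq_sum_dotProduct_mulVec f.toLinearMap hv
  have hr' : ∀ S : Matrix ι ι ℝ, S.IsSymm → f S = ∑ k, r k ⬝ᵥ (S *ᵥ r k) := hr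
  have hf0 : u ≤ f S₀ := by simpa using ht _ ⟨0, rfl⟩
  refine ⟨r, ?_, fun X => ?_, ?_⟩
  · rintro rfl
    have h1 := hs _ (hscal 1 one_pos)
    rw [map_smul, hr' 1 isSymm_one] at h1
    rw [hr' S₀ hS₀] at hf0
    simp at h1 hf0
    linarith
  · rw [← hr' _ (hL X)]
    -- An affine function of `t` that is bounded below has slope zero.
    have h1 : ∀ t : ℝ, u ≤ f S₀ + t * f (L X) := fun t => by
      have := ht _ ⟨t • X, rfl⟩
      simpa using this
    by_contra hne
    have := h1 ((u - f S₀ - 1) / f (L X))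
    rw [div_mul_cancel₀ _ hne] at this
    linarith
  · rw [← hr' S₀ hS₀]
    linarith

end NegForm

/-! ### Diagonalization of isometries -/

section Isometry

/-- A linear isometry of a finite-dimensional complex inner product space into itself has an
orthonormal family of eigenvectors of full size. -/
lemma exists_orthonormal_eigenvectors (d : ℕ) :
    ∀ {V : Type} [NormedAddCommGroup V] [InnerProductSpace ℂ V] [FiniteDimensional ℂ V]
      (_ : Module.finrank ℂ V = d) (T : V →ₗᵢ[ℂ] V),
      ∃ u : Fin d → V, Orthonormal ℂ u ∧ ∀ j, ∃ θ : ℂ, T (u j) = θ • u j := by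
  induction d with
  | zero => exact fun _ T => ⟨Fin.elim0, ⟨fun i => i.elim0, fun i => i.elim0⟩, fun j => j.elim0⟩
  | succ d ih =>
    intro V _ _ _ hd T
    have : Nontrivial V := Module.nontrivial_of_finrank_eq_succ hd
    obtain ⟨θ, hθ⟩ := Module.End.exists_eigenvalue T.toLinearMap
    obtain ⟨v, hv⟩ := hθ.exists_hasEigenvector
    have hv0 : v ≠ 0 := hv.2
    have hTv : T v = θ • v := hv.apply_eq_smul
    have hθ1 : ‖θ‖ = 1 := by
      have := T.norm_map v
      rw [hTv, norm_smul] at this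
      exact mul_right_cancel₀ (norm_ne_zero_iff.mpr hv0) (by rw [this, one_mul])
    have hθ0 : θ ≠ 0 := by
      rintro rfl
      simp at hθ1
    -- The complement of the eigenvector is invariant because `0 = ⟪v, x⟫ = ⟪T v, T x⟫` is a nonzero
    -- multiple of `⟪v, T x⟫`; the induction continues there.
    have hinv : ∀ x ∈ (ℂ ∙ v)ᗮ, T x ∈ (ℂ ∙ v)ᗮ := by
      intro x hx
      rw [Submodule.mem_orthogonal_singleton_iff_inner_right] at hx ⊢
      have h1 : inner ℂ (T v) (T x) = inner ℂ v x := T.inner_map_map v x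
      rw [hTv, inner_smul_left, hx] at h1
      exact (mul_eq_zero.mp h1).resolve_left (by simpa using hθ0)
    let T' : (ℂ ∙ v)ᗮ →ₗᵢ[ℂ] (ℂ ∙ v)ᗮ :=
      { toLinearMap := T.toLinearMap.restrict hinv
        norm_map' := fun x => T.norm_map x }
    have hfr : Module.finrank ℂ (ℂ ∙ v)ᗮ = d := by
      have : Fact (Module.finrank ℂ V = d + 1) := ⟨hd⟩
      exact Submodule.finrank_orthogonal_span_singleton hv0
    obtain ⟨u, hu, hTu⟩ := ih hfr T'
    have hn : ‖v‖ ≠ 0 := norm_ne_zero_iff.mpr hv0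
    refine ⟨Fin.cons ((‖v‖⁻¹ : ℂ) • v) fun j => (u j : V), ⟨fun i => ?_, fun i j hij => ?_⟩,
      fun j => ?_⟩
    · refine Fin.cases ?_ (fun i => ?_) i
      · simp [norm_smul, hn]
      · exact hu.1 i
    · have horth : ∀ k, inner ℂ v (u k : V) = 0 := fun k =>
        (Submodule.mem_orthogonal_singleton_iff_inner_right).mp (u k).2
      rcases Fin.eq_zero_or_eq_succ i with rfl | ⟨i, rfl⟩ <;>
        rcases Fin.eq_zero_or_eq_succ j with rfl | ⟨j, rfl⟩
      · exact absurd rfl hij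
      · simp [inner_smul_left, horth]
      · simp only [Fin.cons_zero, Fin.cons_succ, inner_smul_right]
        rw [← inner_conj_symm, horth]
        simp
      · exact hu.2 fun h => hij (congrArg Fin.succ h)
    · refine Fin.cases ⟨θ, ?_⟩ (fun j => ?_) j
      · rw [Fin.cons_zero, map_smul, hTv, smul_comm]
      · obtain ⟨φ, hφ⟩ := hTu j
        exact ⟨φ, congrArg Subtype.val hφ⟩

/-- If `Re ⟪F c, G c⟫ = 0` for all `c`, the two families of vectors `F c`, `G c` become
proportional (with a common imaginary, possibly infinite, ratio) in a suitable orthonormal basis. -/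
lemma exists_orthonormalBasis_of_re_inner_eq_zero {U V : Type} [AddCommGroup U] [Module ℂ U]
    [NormedAddCommGroup V] [InnerProductSpace ℂ V] [FiniteDimensional ℂ V] (F G : U →ₗ[ℂ] V)
    (h : ∀ c, (inner ℂ (F c) (G c)).re = 0) :
    ∃ b : OrthonormalBasis (Fin (Module.finrank ℂ V)) ℂ V, ∀ j, ∃ θ : ℂ, ‖θ‖ = 1 ∧
      ∀ c, θ * inner ℂ (b j) (F c + G c) = inner ℂ (b j) (F c - G c) := by
  -- The hypothesis says exactly that `F c + G c` and `F c - G c` have equal norms. So `(F - G) c ↦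
  -- (F + G) c` is a well-defined isometry on the range of `F - G`; it is extended to `V` and
  -- diagonalized.
  have hnorm : ∀ c, ‖(F + G) c‖ = ‖(F - G) c‖ := fun c => by
    rw [← sq_eq_sq₀ (norm_nonneg _) (norm_nonneg _), LinearMap.add_apply, LinearMap.sub_apply,
      @norm_add_sq ℂ, @norm_sub_sq ℂ]
    simp [h c]
  have hker : LinearMap.ker (F - G) ≤ LinearMap.ker (F + G) := fun c hc => by
    rw [LinearMap.mem_ker] at hc ⊢
    rw [← norm_eq_zero, hnorm, hc, norm_zero]
  let L₀ : LinearMap.range (F - G) →ₗ[ℂ] V :=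
    (Submodule.liftQ _ (F + G) hker).comp (F - G).quotKerEquivRange.symm.toLinearMap
  have hL₀ : ∀ c, L₀ ⟨(F - G) c, c, rfl⟩ = (F + G) c := fun c => by
    have : (F - G).quotKerEquivRange.symm ⟨(F - G) c, c, rfl⟩ = Submodule.Quotient.mk c := by
      rw [LinearEquiv.symm_apply_eq]
      rfl
    simp only [L₀, LinearMap.comp_apply, LinearEquiv.coe_coe, this]
    exact Submodule.liftQ_apply _ _ _
  let L : LinearMap.range (F - G) →ₗᵢ[ℂ] V :=
    { toLinearMap := L₀
      norm_map' := by
        rintro ⟨_, c, rfl⟩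
        rw [hL₀, hnorm]
        rfl }
  have hT : ∀ c, L.extend ((F - G) c) = (F + G) c := fun c =>
    (LinearIsometry.extend_apply L ⟨(F - G) c, c, rfl⟩).trans (hL₀ c)
  obtain ⟨u, hu, hTu⟩ := exists_orthonormal_eigenvectors _ rfl L.extend
  let b := OrthonormalBasis.mk hu
    (hu.linearIndependent.span_eq_top_of_card_eq_finrank' (by simp)).ge
  have hb : ∀ j, b j = u j := fun j => by simp [b]
  refine ⟨b, fun j => ?_⟩
  obtain ⟨θ, hθ⟩ := hTu j
  refine ⟨(starRingEnd ℂ) θ, ?_, fun c => ?_⟩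
  · have := L.extend.norm_map (u j)
    rw [hθ, norm_smul, hu.1 j, mul_one] at this
    rwa [RCLike.norm_conj]
  · have := L.extend.inner_map_map (u j) ((F - G) c)
    rw [hT, hθ, inner_smul_left] at this
    rw [hb]
    exact this

end Isometry

noncomputable section

/-! ### Quadratic forms of the dissipation inequality -/

section PerformanceForm

variable {n m p : Type} [Fintype n] [Fintype m] [Fintype p]

/-- The derivative of `xᵀ X x` plus the supply rate `γ⁻¹ |z|² - γ |w|²` along
`x' = A x + B w`, `z = C x + D w`. -/
def perfForm (A : Matrix n n ℝ) (B : Matrix n m ℝ) (C : Matrix p n ℝ) (D : Matrix p m ℝ)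
    (γ : ℝ) (X : Matrix n n ℝ) (x : n → ℝ) (w : m → ℝ) : ℝ :=
  2 * (x ⬝ᵥ (X *ᵥ (A *ᵥ x + B *ᵥ w)))
    + γ⁻¹ * ((C *ᵥ x + D *ᵥ w) ⬝ᵥ (C *ᵥ x + D *ᵥ w)) - γ * (w ⬝ᵥ w)

/-- The matrix of the quadratic form `2 xᵀ X (A x + B w)` for symmetric `X`. -/
def lyapMatrix (A : Matrix n n ℝ) (B : Matrix n m ℝ) (X : Matrix n n ℝ) :
    Matrix (n ⊕ m) (n ⊕ m) ℝ :=
  fromBlocks (X * A + Aᵀ * X) (X * B) (Bᵀ * X) 0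

/-- The matrix of the supply rate `γ⁻¹ |C x + D w|² - γ |w|²`. -/
def supplyMatrix [DecidableEq m] (C : Matrix p n ℝ) (D : Matrix p m ℝ) (γ : ℝ) : Matrix (n ⊕ m) (n ⊕ m) ℝ :=
  fromBlocks (γ⁻¹ • (Cᵀ * C)) (γ⁻¹ • (Cᵀ * D)) (γ⁻¹ • (Dᵀ * C))
    (γ⁻¹ • (Dᵀ * D) - γ • (1 : Matrix m m ℝ))

lemma dotProduct_lyapMatrix (A : Matrix n n ℝ) (B : Matrix n m ℝ) {X : Matrix n n ℝ}
    (hX : X.IsSymm) (x : n → ℝ) (w : m → ℝ) :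
    Sum.elim x w ⬝ᵥ (lyapMatrix A B X *ᵥ Sum.elim x w)
      = 2 * (x ⬝ᵥ (X *ᵥ (A *ᵥ x + B *ᵥ w))) := by
  have h1 : ∀ u v : n → ℝ, u ⬝ᵥ (X *ᵥ v) = v ⬝ᵥ (X *ᵥ u) := fun u v => by
    rw [dotProduct_mulVec, ← mulVec_transpose, hX.eq, dotProduct_comm]
  have h2 : x ⬝ᵥ (Aᵀ *ᵥ (X *ᵥ x)) = x ⬝ᵥ (X *ᵥ (A *ᵥ x)) := by
    rw [dotProduct_mulVec, vecMul_transpose, h1]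
  have h3 : w ⬝ᵥ (Bᵀ *ᵥ (X *ᵥ x)) = x ⬝ᵥ (X *ᵥ (B *ᵥ w)) := by
    rw [dotProduct_mulVec, vecMul_transpose, h1]
  simp only [lyapMatrix, fromBlocks_mulVec, Sum.elim_comp_inl, Sum.elim_comp_inr,
    sumElim_dotProduct_sumElim, add_mulVec, dotProduct_add, ← mulVec_mulVec, h2, h3,
    mulVec_add, zero_mulVec, dotProduct_zero]
  ring

lemma dotProduct_supplyMatrix [DecidableEq m] (C : Matrix p n ℝ) (D : Matrix p m ℝ) (γ : ℝ)
    (x : n → ℝ) (w : m → ℝ) :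
    Sum.elim x w ⬝ᵥ (supplyMatrix C D γ *ᵥ Sum.elim x w)
      = γ⁻¹ * ((C *ᵥ x + D *ᵥ w) ⬝ᵥ (C *ᵥ x + D *ᵥ w)) - γ * (w ⬝ᵥ w) := by
  have h1 : ∀ {q : Type} [Fintype q] (M : Matrix p q ℝ) (u : q → ℝ) (v : p → ℝ),
      u ⬝ᵥ (Mᵀ *ᵥ v) = (M *ᵥ u) ⬝ᵥ v := fun M u v => by
    rw [dotProduct_mulVec, vecMul_transpose]
  simp only [supplyMatrix, fromBlocks_mulVec, Sum.elim_comp_inl, Sum.elim_comp_inr,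
    sumElim_dotProduct_sumElim, sub_mulVec, dotProduct_sub, dotProduct_add,
    add_dotProduct, ← mulVec_mulVec, h1, smul_mulVec, dotProduct_smul, one_mulVec, smul_eq_mul]
  ring

omit [Fintype n] [Fintype m] in
lemma isSymm_supplyMatrix [DecidableEq m] (C : Matrix p n ℝ) (D : Matrix p m ℝ) (γ : ℝ) :
    (supplyMatrix C D γ).IsSymm := by
  simp [supplyMatrix, IsSymm, fromBlocks_transpose, transpose_mul]

omit [Fintype m] in
lemma isSymm_lyapMatrix (A : Matrix n n ℝ) (B : Matrix n m ℝ) {X : Matrix n n ℝ} (hX : X.IsSymm) :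
    (lyapMatrix A B X).IsSymm := by
  simp [lyapMatrix, IsSymm, fromBlocks_transpose, transpose_mul, hX.eq, add_comm]

/-- Translates the pointwise dissipation inequality into membership in the open convex set of
negative forms, where duality and perturbation arguments apply. -/
lemma isNegForm_supply_add_lyap_iff [DecidableEq m] (A : Matrix n n ℝ) (B : Matrix n m ℝ) (C : Matrix p n ℝ)
    (D : Matrix p m ℝ) (γ : ℝ) {X : Matrix n n ℝ} (hX : X.IsSymm) :
    IsNegForm (supplyMatrix C D γ + lyapMatrix A B X) ↔
      ∀ x w, (x ≠ 0 ∨ w ≠ 0) → perfForm A B C D γ X x w < 0 := by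
  have key : ∀ x w, Sum.elim x w ⬝ᵥ ((supplyMatrix C D γ + lyapMatrix A B X) *ᵥ Sum.elim x w)
      = perfForm A B C D γ X x w := fun x w => by
    rw [add_mulVec, dotProduct_add, dotProduct_lyapMatrix A B hX, dotProduct_supplyMatrix, perfForm]
    ring
  constructor
  · intro h x w hxw
    rw [← key]
    refine h _ fun h0 => ?_
    rcases hxw with hx | hw
    · exact hx (by ext i; exact congrFun h0 (Sum.inl i))
    · exact hw (by ext i; exact congrFun h0 (Sum.inr i))
  · intro h v hv
    have hve : v = Sum.elim (v ∘ Sum.inl) (v ∘ Sum.inr) := (Sum.elim_comp_inl_inr v).symm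
    rw [hve, key]
    refine h _ _ ?_
    by_contra! h0
    apply hv
    rw [hve, h0.1, h0.2]
    ext i
    cases i <;> rfl

end PerformanceForm

/-! ### The Kalman–Yakubovich–Popov lemma -/

section KYP

variable {n m p : Type} [Fintype n] [Fintype m] [Fintype p]

/-- Coordinates of real vectors in an orthonormal basis of a complex Euclidean space. -/
def realCoord {ι κ : Type} [Fintype ι] [Fintype κ]
    (b : OrthonormalBasis κ ℂ (EuclideanSpace ℂ ι)) (j : κ) : (ι → ℝ) →ₗ[ℝ] ℂ where
  toFun y := inner ℂ (b j) (WithLp.toLp 2 fun k => (y k : ℂ))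
  map_add' y z := by
    rw [← inner_add_right, ← WithLp.toLp_add]
    congr 2
    ext k
    simp
  map_smul' c y := by
    rw [RingHom.id_apply, Complex.real_smul, ← inner_smul_right, ← WithLp.toLp_smul]
    congr 2
    ext k
    simp

/-- Parseval's identity: a unitary change of the summation index preserves sums of squares. -/
lemma sum_norm_sq_realCoord {ι κ : Type} [Fintype ι] [Fintype κ]
    (b : OrthonormalBasis κ ℂ (EuclideanSpace ℂ ι)) (y : ι → ℝ) :
    ∑ j, ‖realCoord b j y‖ ^ 2 = ∑ k, y k * y k := by
  have := b.sum_sq_norm_inner_right (WithLp.toLp 2 fun k => (y k : ℂ))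
  rw [EuclideanSpace.norm_sq_eq] at this
  simpa [← sq, realCoord] using this

/-- The coordinates act on the index `k` and the matrix on the components, so the two operations
commute. -/
lemma realCoord_mulVec {ι κ q : Type} [Fintype ι] [Fintype κ]
    (b : OrthonormalBasis κ ℂ (EuclideanSpace ℂ ι)) (j : κ) (M : Matrix q n ℝ)
    (x : ι → n → ℝ) (i : q) :
    realCoord b j (fun k => (M *ᵥ x k) i)
      = (M.map Complex.ofReal *ᵥ fun a => realCoord b j fun k => x k a) i := by
  have : (fun k => (M *ᵥ x k) i) = ∑ a, M i a • fun k => x k a := by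
    ext k
    simp [mulVec, dotProduct]
  rw [this, map_sum]
  simp [mulVec, dotProduct]

/-- If `∑ k, x k (e k)ᵀ + e k (x k)ᵀ = 0`, then a unitary change of the summation index turns the
vectors `e k` into imaginary (possibly infinite) multiples of the vectors `x k`. -/
lemma exists_realCoord_proportional {ι : Type} [Fintype ι] (x e : ι → n → ℝ)
    (h : ∀ a b, ∑ k, (x k a * e k b + x k b * e k a) = 0) :
    ∃ b : OrthonormalBasis (Fin (Module.finrank ℂ (EuclideanSpace ℂ ι))) ℂ (EuclideanSpace ℂ ι),
      ∀ j, (∀ a, realCoord b j (fun k => x k a) = 0) ∨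
        ∃ ω : ℝ, ∀ a, realCoord b j (fun k => e k a)
          = (ω * Complex.I) * realCoord b j (fun k => x k a) := by
  classical
  let vx : n → EuclideanSpace ℂ ι := fun a => WithLp.toLp 2 fun k => (x k a : ℂ)
  let ve : n → EuclideanSpace ℂ ι := fun a => WithLp.toLp 2 fun k => (e k a : ℂ)
  have hin : ∀ a b, inner ℂ (ve a) (vx b) = ((∑ k, e k a * x k b : ℝ) : ℂ) := fun a b => by
    simp [ve, vx, PiLp.inner_apply, mul_comm]
  have hanti : ∀ a b, inner ℂ (ve a) (vx b) = -inner ℂ (ve b) (vx a) := fun a b => by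
    rw [hin, hin, ← Complex.ofReal_neg, Complex.ofReal_inj, eq_neg_iff_add_eq_zero,
      ← Finset.sum_add_distrib, ← h a b]
    exact Finset.sum_congr rfl fun k _ => by ring
  have hreal : ∀ a b, (starRingEnd ℂ) (inner ℂ (ve a) (vx b)) = inner ℂ (ve a) (vx b) :=
    fun a b => by rw [hin, Complex.conj_ofReal]
  -- The Gram matrix between the families `ve` and `vx` is real and antisymmetric, hence
  -- skew-Hermitian, so its sesquilinear form has zero real part on the diagonal.
  obtain ⟨b, hb⟩ := exists_orthonormalBasis_of_re_inner_eq_zero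
    (Fintype.linearCombination ℂ ve) (Fintype.linearCombination ℂ vx) (fun c => by
      simp only [Fintype.linearCombination_apply, sum_inner, inner_sum, inner_smul_left,
        inner_smul_right, Finset.mul_sum]
      set z := ∑ i, ∑ i', c i * ((starRingEnd ℂ) (c i') * inner ℂ (ve i') (vx i))
      have hconj : (starRingEnd ℂ) z = -z := by
        simp only [z, map_sum, ← Finset.sum_neg_distrib]
        rw [Finset.sum_comm]
        refine Finset.sum_congr rfl fun i _ => Finset.sum_congr rfl fun i' _ => ?_
        rw [map_mul, map_mul, hreal, Complex.conj_conj, hanti i i']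
        ring
      have := congrArg Complex.re hconj
      rw [Complex.conj_re, Complex.neg_re] at this
      linarith)
  refine ⟨b, fun j => ?_⟩
  obtain ⟨θ, hθ, hj⟩ := hb j
  have hj' : ∀ a, θ * (realCoord b j (fun k => e k a) + realCoord b j (fun k => x k a))
      = realCoord b j (fun k => e k a) - realCoord b j (fun k => x k a) := fun a => by
    have := hj (Pi.single a 1)
    rw [Fintype.linearCombination_apply_single, Fintype.linearCombination_apply_single,
      one_smul, one_smul, inner_add_right, inner_sub_right] at this
    exact this
  -- In `θ (e + x) = e - x`, the value `θ = 1` forces `x = 0`. Otherwise `e = (1 + θ) / (1 - θ) x`,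
  -- and this ratio is imaginary because `‖θ‖ = 1`.
  by_cases h1 : θ = 1
  · left
    intro a
    have := hj' a
    rw [h1, one_mul] at this
    linear_combination this / 2
  · right
    have h1' : (1 : ℂ) - θ ≠ 0 := sub_ne_zero.mpr (Ne.symm h1)
    have h2 : θ * (starRingEnd ℂ) θ = 1 := by
      rw [Complex.mul_conj, Complex.normSq_eq_norm_sq, hθ]
      simp
    have h3 : ((1 + θ) / (1 - θ)).re = 0 := by
      have h4 : (starRingEnd ℂ) ((1 + θ) / (1 - θ)) = -((1 + θ) / (1 - θ)) := by
        have h5 : (1 : ℂ) - (starRingEnd ℂ) θ ≠ 0 := by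
          have := (map_ne_zero (starRingEnd ℂ)).mpr h1'
          simpa using this
        rw [map_div₀, map_add, map_sub, map_one, ← neg_div, div_eq_div_iff h5 h1']
        linear_combination -2 * h2
      have := congrArg Complex.re h4
      rw [Complex.conj_re, Complex.neg_re] at this
      linarith
    refine ⟨((1 + θ) / (1 - θ)).im, fun a => ?_⟩
    have h6 : ((((1 + θ) / (1 - θ)).im : ℝ) : ℂ) * Complex.I = (1 + θ) / (1 - θ) := by
      conv_rhs => rw [← Complex.re_add_im ((1 + θ) / (1 - θ)), h3]
      simp
    rw [h6, div_mul_eq_mul_div, eq_div_iff h1']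
    linear_combination -hj' a

/-- **Kalman–Yakubovich–Popov lemma** (strict version, bounded-real supply rate): the frequency
domain inequality yields a symmetric solution of the dissipation inequality. -/
theorem exists_perfForm_neg_of_frequency [DecidableEq n] [DecidableEq m]
    (A : Matrix n n ℝ) (B : Matrix n m ℝ) (C : Matrix p n ℝ)
    (D : Matrix p m ℝ) (γ : ℝ)
    (hfreq : ∀ (x : n → ℂ) (w : m → ℂ), (x ≠ 0 ∨ w ≠ 0) →
      (x = 0 ∨ ∃ ω : ℝ, (ω * Complex.I) • x
        = A.map Complex.ofReal *ᵥ x + B.map Complex.ofReal *ᵥ w) →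
      γ⁻¹ * ∑ i, ‖(C.map Complex.ofReal *ᵥ x + D.map Complex.ofReal *ᵥ w) i‖ ^ 2
        - γ * ∑ i, ‖w i‖ ^ 2 < 0) :
    ∃ X : Matrix n n ℝ, X.IsSymm ∧
      ∀ x w, (x ≠ 0 ∨ w ≠ 0) → perfForm A B C D γ X x w < 0 := by
  -- Writing the unknown as `X + Xᵀ` parametrizes symmetric matrices by a full matrix space.
  let L : Matrix n n ℝ →ₗ[ℝ] Matrix (n ⊕ m) (n ⊕ m) ℝ :=
    { toFun := fun X => lyapMatrix A B (X + Xᵀ)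
      map_add' := fun X Y => by
        simp only [lyapMatrix, fromBlocks_add, transpose_add]
        congr 1 <;> simp only [Matrix.add_mul, Matrix.mul_add, add_zero] <;> abel
      map_smul' := fun c X => by
        simp only [lyapMatrix, fromBlocks_smul, transpose_smul, ← smul_add, RingHom.id_apply]
        congr 1 <;> simp only [Matrix.smul_mul, Matrix.mul_smul, smul_zero, ← smul_add] }
  have hsymm : ∀ X : Matrix n n ℝ, (X + Xᵀ).IsSymm := fun X => by
    simp [IsSymm, add_comm]
  rcases exists_isNegForm_or_exists_dual (supplyMatrix C D γ) (isSymm_supplyMatrix C D γ) L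
    (fun X => isSymm_lyapMatrix A B (hsymm X)) with ⟨X, hX⟩ | ⟨r, hr0, hrL, hrS⟩
  · exact ⟨X + Xᵀ, hsymm X, (isNegForm_supply_add_lyap_iff A B C D γ (hsymm X)).mp hX⟩
  exfalso
  let x : n ⊕ m → n → ℝ := fun k a => r k (Sum.inl a)
  let w : n ⊕ m → m → ℝ := fun k a => r k (Sum.inr a)
  have hr : ∀ k, r k = Sum.elim (x k) (w k) := fun k => (Sum.elim_comp_inl_inr (r k)).symm
  let e : n ⊕ m → n → ℝ := fun k => A *ᵥ x k + B *ᵥ w k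
  -- The dual condition tested on elementary matrices says `∑ (x eᵀ + e xᵀ) = 0`.
  have hxe : ∀ a b, ∑ k, (x k a * e k b + x k b * e k a) = 0 := by
    intro a b
    have h1 := hrL (single a b 1)
    have h2 : ∀ k, r k ⬝ᵥ (L (single a b 1) *ᵥ r k) = 2 * (x k a * e k b + x k b * e k a) := by
      intro k
      rw [hr k]
      refine (dotProduct_lyapMatrix A B (hsymm _) _ _).trans ?_
      have hupd : ∀ (i : n) (c : ℝ), x k ⬝ᵥ Function.update 0 i c = x k i * c := fun i c =>
        dotProduct_single _ _ _
      simp only [add_mulVec, transpose_single, single_mulVec, dotProduct_add, hupd, e, one_mul]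
    simp only [h2, ← Finset.mul_sum] at h1
    linarith
  obtain ⟨b, hb⟩ := exists_realCoord_proportional x e hxe
  set xh := fun j a => realCoord b j fun k => x k a with hxh
  set wh := fun j a => realCoord b j fun k => w k a with hwh
  have hlin : ∀ {q : Type} (M : Matrix q n ℝ) (N : Matrix q m ℝ) j (i : q),
      realCoord b j (fun k => (M *ᵥ x k + N *ᵥ w k) i)
        = (M.map Complex.ofReal *ᵥ xh j + N.map Complex.ofReal *ᵥ wh j) i := by
    intro q M N j i
    rw [Pi.add_apply, ← realCoord_mulVec, ← realCoord_mulVec, ← map_add]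
    rfl
  have hneg : ∀ j, (xh j ≠ 0 ∨ wh j ≠ 0) →
      γ⁻¹ * ∑ i, ‖(C.map Complex.ofReal *ᵥ xh j + D.map Complex.ofReal *ᵥ wh j) i‖ ^ 2
        - γ * ∑ i, ‖wh j i‖ ^ 2 < 0 := by
    intro j hj
    refine hfreq _ _ hj ?_
    -- Each `j` is a single frequency; the alternative `x = 0` plays the role of infinite frequency.
    rcases hb j with h | ⟨ω, h⟩
    · exact Or.inl (funext h)
    · refine Or.inr ⟨ω, ?_⟩
      ext a
      rw [← hlin]
      exact (h a).symm
  have hsum : ∑ k, r k ⬝ᵥ (supplyMatrix C D γ *ᵥ r k)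
      = ∑ j, (γ⁻¹ * ∑ i, ‖(C.map Complex.ofReal *ᵥ xh j + D.map Complex.ofReal *ᵥ wh j) i‖ ^ 2
        - γ * ∑ i, ‖wh j i‖ ^ 2) := by
    have h1 : ∑ j, ∑ i, ‖(C.map Complex.ofReal *ᵥ xh j + D.map Complex.ofReal *ᵥ wh j) i‖ ^ 2
        = ∑ k, (C *ᵥ x k + D *ᵥ w k) ⬝ᵥ (C *ᵥ x k + D *ᵥ w k) := by
      simp_rw [← hlin]
      rw [Finset.sum_comm]
      simp_rw [sum_norm_sq_realCoord]
      exact Finset.sum_comm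
    have h2 : ∑ j, ∑ i, ‖wh j i‖ ^ 2 = ∑ k, w k ⬝ᵥ w k := by
      rw [Finset.sum_comm]
      simp_rw [hwh, sum_norm_sq_realCoord]
      exact Finset.sum_comm
    rw [Finset.sum_sub_distrib, ← Finset.mul_sum, ← Finset.mul_sum, h1, h2, Finset.mul_sum,
      Finset.mul_sum, ← Finset.sum_sub_distrib]
    refine Finset.sum_congr rfl fun k _ => ?_
    rw [hr k, dotProduct_supplyMatrix]
  -- The dual sum is nonnegative, yet each nonzero pair `(xh j, wh j)` contributes a negative term.
  -- So all pairs vanish, which contradicts `r ≠ 0`.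
  have hall : ∀ j, xh j = 0 ∧ wh j = 0 := by
    by_contra! hne
    obtain ⟨j, hj⟩ := hne
    rw [hsum] at hrS
    refine absurd hrS (not_le.mpr ?_)
    refine Finset.sum_neg' (fun j _ => ?_) ⟨j, Finset.mem_univ _, hneg j ?_⟩
    · by_cases h0 : xh j ≠ 0 ∨ wh j ≠ 0
      · exact (hneg j h0).le
      · push Not at h0
        rw [h0.1, h0.2]
        simp
    · by_cases hx : xh j = 0
      · exact Or.inr (hj hx)
      · exact Or.inl hx
  have hzero : ∀ y : n ⊕ m → ℝ, (∀ j, realCoord b j y = 0) → ∀ k, y k = 0 := by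
    intro y hy k
    have := sum_norm_sq_realCoord b y
    simp only [hy, norm_zero, ne_eq, OfNat.ofNat_ne_zero, not_false_eq_true, zero_pow,
      Finset.sum_const_zero] at this
    have h1 := (Finset.sum_eq_zero_iff_of_nonneg fun k _ => mul_self_nonneg (y k)).mp this.symm k
      (Finset.mem_univ k)
    exact mul_self_eq_zero.mp h1
  apply hr0
  ext k a
  cases a with
  | inl a => exact hzero (fun k => x k a) (fun j => congrFun (hall j).1 a) k
  | inr a => exact hzero (fun k => w k a) (fun j => congrFun (hall j).2 a) k

end KYP

end

/-! ### Lyapunov's theorem via the Cayley transform -/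

section Lyapunov

variable {n : Type} [Fintype n] [DecidableEq n]

lemma mem_spectrum_iff_exists_mulVec_eq {M : Matrix n n ℂ} {s : ℂ} :
    s ∈ spectrum ℂ M ↔ ∃ v : n → ℂ, v ≠ 0 ∧ M *ᵥ v = s • v := by
  rw [spectrum.mem_iff, isUnit_iff_isUnit_det, isUnit_iff_ne_zero, not_not,
    ← exists_mulVec_eq_zero_iff]
  refine exists_congr fun v => and_congr_right fun _ => ?_
  rw [sub_mulVec, sub_eq_zero, Algebra.algebraMap_eq_smul_one, smul_mulVec, one_mulVec, eq_comm]

attribute [local instance] Matrix.linftyOpNormedRing Matrix.linftyOpNormedAlgebra in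
/-- Powers of a complex matrix whose eigenvalues lie in the open unit disc tend to zero. -/
lemma tendsto_pow_mulVec_zero (M : Matrix n n ℂ) (h : ∀ s ∈ spectrum ℂ M, ‖s‖ < 1) (v : n → ℂ) :
    Filter.Tendsto (fun k : ℕ => (M ^ k) *ᵥ v) Filter.atTop (nhds 0) := by
  rcases isEmpty_or_nonempty n with hn | hn
  · have : (fun k : ℕ => (M ^ k) *ᵥ v) = fun _ => 0 := by
      ext k i
      exact isEmptyElim i
    rw [this]
    exact tendsto_const_nhds
  have hρ : spectralRadius ℂ M < (1 : NNReal) :=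
    spectrum.spectralRadius_lt_of_forall_lt M (r := 1) h
  obtain ⟨r, hr1, hr2⟩ := exists_between hρ
  have hpow : Filter.Tendsto (fun k : ℕ => (‖M ^ k‖₊ : ENNReal)) Filter.atTop (nhds 0) := by
    refine tendsto_of_tendsto_of_tendsto_of_le_of_le' tendsto_const_nhds
      (ENNReal.tendsto_pow_atTop_nhds_zero_of_lt_one (by simpa using hr2))
      (Filter.Eventually.of_forall fun _ => zero_le) ?_
    -- Gelfand's formula: eventually `‖M ^ k‖ ≤ r ^ k` with `r < 1`.
    filter_upwards [(spectrum.pow_nnnorm_pow_one_div_tendsto_nhds_spectralRadius M).eventually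
      (gt_mem_nhds hr1), Filter.eventually_gt_atTop 0] with k hk hk0
    have hk' : (0 : ℝ) < k := by exact_mod_cast hk0
    have := ENNReal.rpow_le_rpow hk.le hk'.le
    rwa [← ENNReal.rpow_mul, one_div_mul_cancel hk'.ne', ENNReal.rpow_one,
      ENNReal.rpow_natCast] at this
  have hpow' : Filter.Tendsto (fun k : ℕ => ‖M ^ k‖ * ‖v‖) Filter.atTop (nhds 0) := by
    have := ((ENNReal.tendsto_toReal ENNReal.zero_ne_top).comp hpow).mul_const ‖v‖
    simpa using this
  exact squeeze_zero_norm (fun k => linfty_opNorm_mulVec (M ^ k) v) hpow'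

/-- The numerator of the real part is `‖s‖² - 1`. -/
lemma norm_lt_one_of_cayley_re_neg {s : ℂ} (h1 : s ≠ -1) (h : ((s - 1) / (s + 1)).re < 0) :
    ‖s‖ < 1 := by
  have h2 : s + 1 ≠ 0 := fun h0 => h1 (eq_neg_of_add_eq_zero_left h0)
  rw [Complex.div_re, ← add_div, div_neg_iff] at h
  have h3 : 0 < Complex.normSq (s + 1) := Complex.normSq_pos.mpr h2
  have h4 : (s - 1).re * (s + 1).re + (s - 1).im * (s + 1).im < 0 := by
    rcases h with h | h
    · exact absurd h.2 (not_lt.mpr h3.le)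
    · exact h.1
  have h5 : ‖s‖ ^ 2 < 1 := by
    rw [← Complex.normSq_eq_norm_sq, Complex.normSq_apply]
    simp at h4
    nlinarith
  nlinarith [norm_nonneg s]

/-- **Lyapunov's theorem**: a symmetric solution of the strict Lyapunov inequality of a Hurwitz
matrix is positive definite. -/
theorem posDef_of_isHurwitz {A X : Matrix n n ℝ} (hA : IsHurwitz A) (hX : X.IsSymm)
    (h : ∀ x, x ≠ 0 → x ⬝ᵥ (X *ᵥ (A *ᵥ x)) < 0) : X.PosDef := by
  set Ac : Matrix n n ℂ := A.map Complex.ofReal with hAc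
  have hunit : IsUnit (1 - A) := by
    rw [isUnit_iff_isUnit_det, isUnit_iff_ne_zero]
    intro h0
    obtain ⟨v, hv, hv0⟩ := exists_mulVec_eq_zero_iff.mpr h0
    have h1 : (1 : ℂ) ∈ spectrum ℂ Ac := by
      refine mem_spectrum_iff_exists_mulVec_eq.mpr ⟨fun i => (v i : ℂ), fun h => hv ?_, ?_⟩
      · ext i
        simpa using congrFun h i
      · rw [sub_mulVec, one_mulVec, sub_eq_zero] at hv0
        ext i
        have := congrArg Complex.ofReal (congrFun hv0 i)
        simp only [mulVec, dotProduct, Complex.ofReal_sum, Complex.ofReal_mul] at this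
        simp [mulVec, dotProduct, hAc, this]
    have := hA 1 h1
    simp at this
    linarith
  have hdet := (isUnit_iff_isUnit_det _).mp hunit
  -- The Cayley transform replaces the flow of `A` by powers of `T`, so no matrix exponential is
  -- needed: an eigenvalue `s` of `T` gives the eigenvalue `(s - 1) / (s + 1)` of `A`, hence `‖s‖ <
  -- 1` and `T ^ k → 0`.
  set T : Matrix n n ℝ := (1 + A) * (1 - A)⁻¹ with hT
  have hTc : T.map Complex.ofReal * (1 - Ac) = 1 + Ac := by
    have h1 : T * (1 - A) = 1 + A := by
      rw [hT, Matrix.mul_assoc, nonsing_inv_mul _ hdet, Matrix.mul_one]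
    have h2 := congrArg (fun M : Matrix n n ℝ => M.map Complex.ofRealHom) h1
    simp only [Matrix.map_mul, Matrix.map_add, Matrix.map_sub, map_add, map_sub,
      Matrix.map_one, map_zero, map_one, implies_true] at h2
    exact h2
  have hcomm : T * (1 - A) = (1 - A) * T := by
    have h1 : (1 - A) * (1 + A) = (1 + A) * (1 - A) := by noncomm_ring
    rw [hT, ← Matrix.mul_assoc, h1, Matrix.mul_assoc, Matrix.mul_assoc, nonsing_inv_mul _ hdet,
      mul_nonsing_inv _ hdet]
  have hTc' : (1 - Ac) * T.map Complex.ofReal = 1 + Ac := by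
    rw [← hTc]
    have h2 := congrArg (fun M : Matrix n n ℝ => M.map Complex.ofRealHom) hcomm.symm
    simp only [Matrix.map_mul, Matrix.map_sub, map_sub,
      Matrix.map_one, map_zero, map_one, implies_true] at h2
    exact h2
  have hspec : ∀ s ∈ spectrum ℂ (T.map Complex.ofReal), ‖s‖ < 1 := by
    intro s hs
    obtain ⟨v, hv, hTv⟩ := mem_spectrum_iff_exists_mulVec_eq.mp hs
    have h1 : (1 + Ac) *ᵥ v = s • ((1 - Ac) *ᵥ v) := by
      rw [← hTc', ← mulVec_mulVec, hTv, mulVec_smul]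
    rw [add_mulVec, sub_mulVec, one_mulVec] at h1
    have h2 : (s + 1) • (Ac *ᵥ v) = (s - 1) • v := by
      rw [smul_sub] at h1
      have := sub_eq_zero.mpr h1
      rw [← sub_eq_zero, ← this]
      module
    have hs1 : s ≠ -1 := by
      rintro rfl
      simp only [neg_add_cancel, zero_smul] at h2
      have := (smul_eq_zero.mp h2.symm).resolve_left (by norm_num)
      exact hv this
    have hs2 : s + 1 ≠ 0 := fun h0 => hs1 (eq_neg_of_add_eq_zero_left h0)
    refine norm_lt_one_of_cayley_re_neg hs1 (hA _ ?_)
    refine mem_spectrum_iff_exists_mulVec_eq.mpr ⟨v, hv, ?_⟩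
    rw [div_eq_inv_mul, ← smul_smul, ← h2, smul_smul, inv_mul_cancel₀ hs2, one_smul]
  have htend : ∀ x : n → ℝ, Filter.Tendsto (fun k : ℕ => (T ^ k) *ᵥ x) Filter.atTop (nhds 0) := by
    intro x
    have h1 := tendsto_pow_mulVec_zero (T.map Complex.ofReal) hspec fun i => (x i : ℂ)
    rw [tendsto_pi_nhds] at h1 ⊢
    intro i
    have h2 := (Complex.continuous_re.tendsto _).comp (h1 i)
    simp only [Pi.zero_apply, Complex.zero_re] at h2 ⊢
    refine h2.congr fun k => ?_
    have h3 : (T.map Complex.ofReal) ^ k = (T ^ k).map Complex.ofReal :=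
      (Matrix.map_pow T Complex.ofRealHom k).symm
    simp only [Function.comp_apply, h3, mulVec, dotProduct, map_apply, ← Complex.ofReal_mul,
      ← Complex.ofReal_sum, Complex.ofReal_re]
  -- With `x = y - A y` and `T x = y + A y`, the form changes by `4 yᵀ X A y < 0`. It decreases
  -- along `T ^ k x` to the limit `0`, so it is nonnegative; the strict first step makes it
  -- positive.
  have hdec : ∀ x, x ≠ 0 → (T *ᵥ x) ⬝ᵥ (X *ᵥ (T *ᵥ x)) < x ⬝ᵥ (X *ᵥ x) := by
    intro x hx
    set y := (1 - A)⁻¹ *ᵥ x with hy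
    have hxy : x = y - A *ᵥ y := by
      have h1 : (1 - A) *ᵥ y = x := by
        rw [hy, mulVec_mulVec, mul_nonsing_inv _ hdet, one_mulVec]
      rw [← h1, sub_mulVec, one_mulVec]
    have hTx : T *ᵥ x = y + A *ᵥ y := by
      rw [hT, ← mulVec_mulVec, add_mulVec, one_mulVec]
    have hy0 : y ≠ 0 := by
      rintro h0
      rw [h0] at hxy
      simp at hxy
      exact hx hxy
    have hsym : (A *ᵥ y) ⬝ᵥ (X *ᵥ y) = y ⬝ᵥ (X *ᵥ (A *ᵥ y)) := by
      rw [dotProduct_mulVec, ← mulVec_transpose, hX.eq, dotProduct_comm]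
    have := h y hy0
    rw [hTx, hxy]
    simp only [mulVec_add, mulVec_sub, dotProduct_add, dotProduct_sub, add_dotProduct,
      sub_dotProduct, hsym]
    linarith
  have hdec' : ∀ x, (T *ᵥ x) ⬝ᵥ (X *ᵥ (T *ᵥ x)) ≤ x ⬝ᵥ (X *ᵥ x) := fun x => by
    by_cases hx : x = 0
    · simp [hx]
    · exact (hdec x hx).le
  have hnonneg : ∀ x, 0 ≤ x ⬝ᵥ (X *ᵥ x) := by
    intro x
    have h1 : ∀ k : ℕ, ((T ^ k) *ᵥ x) ⬝ᵥ (X *ᵥ ((T ^ k) *ᵥ x)) ≤ x ⬝ᵥ (X *ᵥ x) := by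
      intro k
      induction k with
      | zero => simp
      | succ k ih =>
        rw [pow_succ', ← mulVec_mulVec]
        exact (hdec' _).trans ih
    have hc : Continuous fun v : n → ℝ => v ⬝ᵥ (X *ᵥ v) :=
      continuous_id.dotProduct (continuous_const.matrix_mulVec continuous_id)
    have h2 := (hc.tendsto 0).comp (htend x)
    simp only [zero_dotProduct] at h2
    exact le_of_tendsto' h2 h1
  refine PosDef.of_dotProduct_mulVec_pos ?_ fun x hx => ?_
  · rw [IsHermitian, conjTranspose_eq_transpose_of_trivial, hX.eq]
  · rw [star_trivial]
    exact (hnonneg _).trans_lt (hdec x hx)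

end Lyapunov

/-! ### The bounded real lemma -/

section BoundedReal

variable {n m p : Type} [Fintype n] [Fintype m] [Fintype p]

omit [Fintype p] in
lemma re_map_mulVec (M : Matrix p n ℝ) (x : n → ℂ) (i : p) :
    ((M.map Complex.ofReal *ᵥ x) i).re = (M *ᵥ fun a => (x a).re) i := by
  simp [mulVec, dotProduct, Complex.re_sum]

omit [Fintype p] in
lemma im_map_mulVec (M : Matrix p n ℝ) (x : n → ℂ) (i : p) :
    ((M.map Complex.ofReal *ᵥ x) i).im = (M *ᵥ fun a => (x a).im) i := by
  simp [mulVec, dotProduct, Complex.im_sum]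

lemma sum_norm_sq_eq (v : n → ℂ) : ∑ i, ‖v i‖ ^ 2
    = (fun i => (v i).re) ⬝ᵥ (fun i => (v i).re) + (fun i => (v i).im) ⬝ᵥ (fun i => (v i).im) := by
  simp only [dotProduct, ← Finset.sum_add_distrib, ← Complex.normSq_eq_norm_sq,
    Complex.normSq_apply]

lemma sum_norm_sq_pos {v : n → ℂ} (hv : v ≠ 0) : 0 < ∑ i, ‖v i‖ ^ 2 := by
  obtain ⟨i, hi⟩ := Function.ne_iff.mp hv
  exact Finset.sum_pos' (fun _ _ => by positivity)
    ⟨i, Finset.mem_univ i, by have := norm_pos_iff.mpr hi; positivity⟩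

section Frequency

variable [DecidableEq n]

lemma isUnit_det_smul_one_sub {A : Matrix n n ℝ} (hA : IsHurwitz A) {s : ℂ} (hs : 0 ≤ s.re) :
    IsUnit (s • (1 : Matrix n n ℂ) - A.map Complex.ofReal).det := by
  rw [← isUnit_iff_isUnit_det, ← Algebra.algebraMap_eq_smul_one]
  by_contra h
  exact absurd (hA s h) (not_lt.mpr hs)

lemma continuousAt_nonsing_inv {Y : Type*} [TopologicalSpace Y] {f : Y → Matrix n n ℂ} {a : Y}
    (hf : Continuous f) (ha : (f a).det ≠ 0) : ContinuousAt (fun s => (f s)⁻¹) a := by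
  simp only [Matrix.inv_def, Ring.inverse_eq_inv']
  exact (hf.matrix_det.continuousAt.inv₀ ha).smul hf.matrix_adjugate.continuousAt

omit [DecidableEq n] in
lemma continuous_sum_norm_sq_mulVec (B : Matrix n m ℝ) (C : Matrix p n ℝ) (D : Matrix p m ℝ)
    (w : m → ℂ) :
    Continuous fun N : Matrix n n ℂ => ∑ i, ‖((C.map Complex.ofReal * N * B.map Complex.ofReal
      + D.map Complex.ofReal) *ᵥ w) i‖ ^ 2 := by
  have h : Continuous fun N : Matrix n n ℂ => (C.map Complex.ofReal * N * B.map Complex.ofReal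
      + D.map Complex.ofReal) *ᵥ w :=
    (((continuous_const.matrix_mul continuous_id).matrix_mul continuous_const).add
      continuous_const).matrix_mulVec continuous_const
  exact continuous_finsetSum _ fun i _ => (continuous_pi_iff.mp h i).norm.pow 2

variable [DecidableEq m] {A : Matrix n n ℝ} {B : Matrix n m ℝ} {C : Matrix p n ℝ}
  {D : Matrix p m ℝ}

lemma sum_norm_sq_transferFunction_le {c : ℝ} (hc : 0 ≤ c)
    (h : hinfNorm (transferFunction A B C D) ≤ ENNReal.ofReal c) {s : ℂ} (hs : 0 < s.re)
    (w : m → ℂ) :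
    ∑ i, ‖(transferFunction A B C D s *ᵥ w) i‖ ^ 2 ≤ c ^ 2 * ∑ i, ‖w i‖ ^ 2 := by
  have h1 : ENNReal.ofReal ‖LinearMap.toContinuousLinearMap
      (Matrix.toEuclideanLin (transferFunction A B C D s))‖ ≤ ENNReal.ofReal c :=
    (le_iSup₂ (f := fun (s : ℂ) (_ : 0 < s.re) => ENNReal.ofReal ‖LinearMap.toContinuousLinearMap
      (Matrix.toEuclideanLin (transferFunction A B C D s))‖) s hs).trans h
  have h2 := (LinearMap.toContinuousLinearMap
    (Matrix.toEuclideanLin (transferFunction A B C D s))).le_of_opNorm_le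
      ((ENNReal.ofReal_le_ofReal_iff hc).mp h1) (WithLp.toLp 2 w)
  have h3 := pow_le_pow_left₀ (norm_nonneg _) h2 2
  rw [mul_pow, EuclideanSpace.norm_sq_eq, EuclideanSpace.norm_sq_eq] at h3
  exact h3

/-- An `H∞` bound extends from the open right half-plane to the imaginary axis. -/
lemma sum_norm_sq_output_le_of_imaginary (hA : IsHurwitz A) {c : ℝ} (hc : 0 ≤ c)
    (h : hinfNorm (transferFunction A B C D) ≤ ENNReal.ofReal c) (ω : ℝ) {x : n → ℂ} {w : m → ℂ}
    (hx : (ω * Complex.I) • x = A.map Complex.ofReal *ᵥ x + B.map Complex.ofReal *ᵥ w) :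
    ∑ i, ‖(C.map Complex.ofReal *ᵥ x + D.map Complex.ofReal *ᵥ w) i‖ ^ 2
      ≤ c ^ 2 * ∑ i, ‖w i‖ ^ 2 := by
  set s₀ : ℂ := ω * Complex.I with hs₀
  have hdet := isUnit_det_smul_one_sub hA (s := s₀) (by simp [hs₀])
  have hG : transferFunction A B C D s₀ *ᵥ w
      = C.map Complex.ofReal *ᵥ x + D.map Complex.ofReal *ᵥ w := by
    have h1 : (s₀ • (1 : Matrix n n ℂ) - A.map Complex.ofReal) *ᵥ x
        = B.map Complex.ofReal *ᵥ w := by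
      rw [sub_mulVec, smul_mulVec, one_mulVec, hx, add_sub_cancel_left]
    rw [transferFunction, add_mulVec, ← mulVec_mulVec, ← h1, ← mulVec_mulVec, mulVec_mulVec x,
      nonsing_inv_mul _ hdet, one_mulVec]
  have hcont : ContinuousAt (fun s => ∑ i, ‖(transferFunction A B C D s *ᵥ w) i‖ ^ 2) s₀ := by
    have h1 : ContinuousAt (fun s : ℂ => (s • (1 : Matrix n n ℂ) - A.map Complex.ofReal)⁻¹) s₀ :=
      continuousAt_nonsing_inv (by fun_prop) hdet.ne_zero
    exact (continuous_sum_norm_sq_mulVec B C D w).continuousAt.comp h1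
  -- The resolvent is continuous at points of the imaginary axis, which are approached horizontally
  -- from the right.
  have htend : Filter.Tendsto (fun ε : ℝ => s₀ + ε) (nhdsWithin 0 (Set.Ioi 0)) (nhds s₀) := by
    have : Continuous fun ε : ℝ => s₀ + (ε : ℂ) := by fun_prop
    simpa using (this.tendsto 0).mono_left nhdsWithin_le_nhds
  rw [← hG]
  refine le_of_tendsto (hcont.tendsto.comp htend) ?_
  filter_upwards [self_mem_nhdsWithin] with ε hε
  exact sum_norm_sq_transferFunction_le hc h (by simpa [hs₀] using hε) w

/-- An `H∞` bound also bounds the feed-through matrix. -/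
lemma sum_norm_sq_feedthrough_le (hA : IsHurwitz A) {c : ℝ} (hc : 0 ≤ c)
    (h : hinfNorm (transferFunction A B C D) ≤ ENNReal.ofReal c) (w : m → ℂ) :
    ∑ i, ‖(D.map Complex.ofReal *ᵥ w) i‖ ^ 2 ≤ c ^ 2 * ∑ i, ‖w i‖ ^ 2 := by
  set Ac := A.map Complex.ofReal with hAc
  -- For `t > 0`, `N t` is the resolvent at `s = 1 / t`. This form is continuous at `t = 0` with
  -- value `0`, so `t → 0` isolates `D`.
  let N : ℝ → Matrix n n ℂ := fun t => (t : ℂ) • (1 - (t : ℂ) • Ac)⁻¹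
  have h1 : ContinuousAt N 0 := by
    refine Complex.continuous_ofReal.continuousAt.smul ?_
    exact continuousAt_nonsing_inv (f := fun t : ℝ => 1 - (t : ℂ) • Ac) (by fun_prop) (by simp)
  have h3 : Filter.Tendsto (fun t => ∑ i, ‖((C.map Complex.ofReal * N t
      * B.map Complex.ofReal + D.map Complex.ofReal) *ᵥ w) i‖ ^ 2) (nhdsWithin 0 (Set.Ioi 0))
      (nhds (∑ i, ‖(D.map Complex.ofReal *ᵥ w) i‖ ^ 2)) := by
    have h4 := ((continuous_sum_norm_sq_mulVec B C D w).continuousAt.comp h1).tendsto.mono_left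
      (nhdsWithin_le_nhds (s := Set.Ioi (0 : ℝ)))
    have h5 : N 0 = 0 := by simp [N]
    simp only [Function.comp_def, h5, Matrix.mul_zero, Matrix.zero_mul, zero_add] at h4
    exact h4
  refine le_of_tendsto h3 ?_
  filter_upwards [self_mem_nhdsWithin] with t ht
  have ht' : (0 : ℝ) < t := ht
  have htc : (t : ℂ) ≠ 0 := by exact_mod_cast ht'.ne'
  have hre : 0 < ((t : ℂ)⁻¹).re := by
    rw [← Complex.ofReal_inv, Complex.ofReal_re]
    positivity
  have hdet := isUnit_det_smul_one_sub hA hre.le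
  have h6 : 1 - (t : ℂ) • Ac = (t : ℂ) • ((t : ℂ)⁻¹ • (1 : Matrix n n ℂ) - Ac) := by
    rw [smul_sub, smul_smul, mul_inv_cancel₀ htc, one_smul]
  have h7 : N t = ((t : ℂ)⁻¹ • (1 : Matrix n n ℂ) - Ac)⁻¹ := by
    symm
    refine inv_eq_right_inv ?_
    simp only [N]
    rw [Matrix.mul_smul, ← Matrix.smul_mul, ← h6, mul_nonsing_inv]
    rw [h6, det_smul]
    exact (IsUnit.mk0 _ (pow_ne_zero _ htc)).mul hdet
  rw [h7]
  exact sum_norm_sq_transferFunction_le hc h hre w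

/-- **Bounded real lemma**, from the frequency domain to the Lyapunov matrix. -/
theorem exists_posDef_perfForm_neg {γ : ℝ} (hγ : 0 < γ) (hA : IsHurwitz A)
    (h : hinfNorm (transferFunction A B C D) < ENNReal.ofReal γ) :
    ∃ X : Matrix n n ℝ, X.PosDef ∧
      ∀ x w, (x ≠ 0 ∨ w ≠ 0) → perfForm A B C D γ X x w < 0 := by
  -- The gap between the norm `c` and `γ` turns the nonstrict frequency bounds into strict ones for
  -- `w ≠ 0`. On the imaginary axis `w = 0` would make `iω` an eigenvalue of `A`.
  set c := (hinfNorm (transferFunction A B C D)).toReal with hc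
  have hc0 : 0 ≤ c := ENNReal.toReal_nonneg
  have hle : hinfNorm (transferFunction A B C D) ≤ ENNReal.ofReal c :=
    (ENNReal.ofReal_toReal h.ne_top).ge
  have hcγ : c < γ := by
    rw [← ENNReal.ofReal_lt_ofReal_iff hγ, hc, ENNReal.ofReal_toReal h.ne_top]
    exact h
  have hlt : ∀ (z : p → ℂ) (w : m → ℂ), w ≠ 0 → ∑ i, ‖z i‖ ^ 2 ≤ c ^ 2 * ∑ i, ‖w i‖ ^ 2 →
      γ⁻¹ * ∑ i, ‖z i‖ ^ 2 - γ * ∑ i, ‖w i‖ ^ 2 < 0 := by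
    intro z w hw hz
    have h1 := sum_norm_sq_pos hw
    have h2 : c ^ 2 < γ ^ 2 := pow_lt_pow_left₀ hcγ hc0 two_ne_zero
    have h3 : γ⁻¹ * ∑ i, ‖z i‖ ^ 2 ≤ γ⁻¹ * (c ^ 2 * ∑ i, ‖w i‖ ^ 2) := by gcongr
    have h4 : γ⁻¹ * (c ^ 2 * ∑ i, ‖w i‖ ^ 2) < γ⁻¹ * (γ ^ 2 * ∑ i, ‖w i‖ ^ 2) := by gcongr
    have h5 : γ⁻¹ * (γ ^ 2 * ∑ i, ‖w i‖ ^ 2) = γ * ∑ i, ‖w i‖ ^ 2 := by field_simp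
    linarith
  obtain ⟨X, hX, hneg⟩ := exists_perfForm_neg_of_frequency A B C D γ (fun x w hxw hfr => by
    rcases hfr with rfl | ⟨ω, hω⟩
    · have hw := hxw.resolve_left (fun h => h rfl)
      refine hlt _ w hw ?_
      simpa using sum_norm_sq_feedthrough_le hA hc0 hle w
    · refine hlt _ w ?_ (sum_norm_sq_output_le_of_imaginary hA hc0 hle ω hω)
      rintro rfl
      have hx := hxw.resolve_right (fun h => h rfl)
      have h1 : (ω * Complex.I : ℂ) ∈ spectrum ℂ (A.map Complex.ofReal) :=
        mem_spectrum_iff_exists_mulVec_eq.mpr ⟨x, hx, by simpa using hω.symm⟩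
      simpa using hA _ h1)
  -- At `w = 0` the dissipation inequality contains the strict Lyapunov inequality.
  refine ⟨X, posDef_of_isHurwitz hA hX fun x hx => ?_, hneg⟩
  have h1 := hneg x 0 (Or.inl hx)
  simp only [perfForm, mulVec_zero, add_zero, dotProduct_zero, mul_zero, sub_zero] at h1
  have h2 : 0 ≤ (C *ᵥ x) ⬝ᵥ (C *ᵥ x) := by
    simpa using dotProduct_star_self_nonneg (C *ᵥ x)
  have h3 : 0 ≤ γ⁻¹ * ((C *ᵥ x) ⬝ᵥ (C *ᵥ x)) := by positivity
  linarith

/-- The real inequality, with a uniform margin `ε`, is added up over real and imaginary parts. The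
`Im s` terms cancel by symmetry of `X`, and the remaining `2 Re s · x* X x` is nonnegative and can
be dropped. -/
lemma exists_complex_dissipation {γ : ℝ} {X : Matrix n n ℝ} (hX : X.PosDef)
    (h : ∀ x w, (x ≠ 0 ∨ w ≠ 0) → perfForm A B C D γ X x w < 0) :
    ∃ ε : ℝ, 0 < ε ∧ ∀ (s : ℂ) (x : n → ℂ) (w : m → ℂ), 0 ≤ s.re →
      s • x = A.map Complex.ofReal *ᵥ x + B.map Complex.ofReal *ᵥ w →
      γ⁻¹ * ∑ i, ‖(C.map Complex.ofReal *ᵥ x + D.map Complex.ofReal *ᵥ w) i‖ ^ 2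
        - γ * ∑ i, ‖w i‖ ^ 2 ≤ -ε * (∑ i, ‖x i‖ ^ 2 + ∑ i, ‖w i‖ ^ 2) := by
  have hsym : X.IsSymm := by
    have := hX.isHermitian
    rwa [IsHermitian, conjTranspose_eq_transpose_of_trivial] at this
  obtain ⟨ε, hε, hneg⟩ :=
    ((isNegForm_supply_add_lyap_iff A B C D γ hsym).mpr h).exists_add_smul_one
  refine ⟨ε, hε, fun s x w hs hx => ?_⟩
  have hreal : ∀ (a : n → ℝ) (u : m → ℝ),
      perfForm A B C D γ X a u ≤ -ε * (a ⬝ᵥ a + u ⬝ᵥ u) := by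
    intro a u
    by_cases h0 : Sum.elim a u = 0
    · have ha : a = 0 := by ext i; exact congrFun h0 (Sum.inl i)
      have hu : u = 0 := by ext i; exact congrFun h0 (Sum.inr i)
      simp [ha, hu, perfForm]
    · have h1 := hneg _ h0
      rw [add_mulVec, dotProduct_add, add_mulVec, dotProduct_add, dotProduct_lyapMatrix A B hsym,
        dotProduct_supplyMatrix, smul_mulVec, one_mulVec, dotProduct_smul,
        sumElim_dotProduct_sumElim, smul_eq_mul] at h1
      rw [perfForm]
      linarith
  have h1 := hreal (fun i => (x i).re) (fun i => (w i).re)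
  have h2 := hreal (fun i => (x i).im) (fun i => (w i).im)
  have hre : (A *ᵥ (fun i => (x i).re) + B *ᵥ fun i => (w i).re)
      = s.re • (fun i => (x i).re) - s.im • fun i => (x i).im := by
    ext i
    have := congrArg Complex.re (congrFun hx i)
    simp only [Pi.add_apply, Complex.add_re, re_map_mulVec, Pi.smul_apply, smul_eq_mul,
      Complex.mul_re] at this
    simp [this]
  have him : (A *ᵥ (fun i => (x i).im) + B *ᵥ fun i => (w i).im)
      = s.re • (fun i => (x i).im) + s.im • fun i => (x i).re := by
    ext i
    have := congrArg Complex.im (congrFun hx i)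
    simp only [Pi.add_apply, Complex.add_im, im_map_mulVec, Pi.smul_apply, smul_eq_mul,
      Complex.mul_im] at this
    simp [this]
  have hswap : (fun i => (x i).re) ⬝ᵥ (X *ᵥ fun i => (x i).im)
      = (fun i => (x i).im) ⬝ᵥ (X *ᵥ fun i => (x i).re) := by
    rw [dotProduct_mulVec, ← mulVec_transpose, hsym.eq, dotProduct_comm]
  have hp1 := hX.posSemidef.dotProduct_mulVec_nonneg fun i => (x i).re
  have hp2 := hX.posSemidef.dotProduct_mulVec_nonneg fun i => (x i).im
  rw [star_trivial] at hp1 hp2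
  have hz : ∑ i, ‖(C.map Complex.ofReal *ᵥ x + D.map Complex.ofReal *ᵥ w) i‖ ^ 2
      = (C *ᵥ (fun i => (x i).re) + D *ᵥ fun i => (w i).re) ⬝ᵥ
          (C *ᵥ (fun i => (x i).re) + D *ᵥ fun i => (w i).re)
        + (C *ᵥ (fun i => (x i).im) + D *ᵥ fun i => (w i).im) ⬝ᵥ
          (C *ᵥ (fun i => (x i).im) + D *ᵥ fun i => (w i).im) := by
    rw [sum_norm_sq_eq]
    simp only [Pi.add_apply, Complex.add_re, Complex.add_im, re_map_mulVec, im_map_mulVec]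
    rfl
  rw [perfForm, hre] at h1
  rw [perfForm, him] at h2
  simp only [mulVec_add, mulVec_sub, mulVec_smul, dotProduct_add, dotProduct_sub,
    dotProduct_smul, smul_eq_mul, hswap] at h1 h2
  rw [hz, sum_norm_sq_eq, sum_norm_sq_eq]
  simp only [dotProduct_add, add_dotProduct] at h1 h2 ⊢
  nlinarith [mul_nonneg hs hp1, mul_nonneg hs hp2]

/-- **Bounded real lemma**, from the Lyapunov matrix to the frequency domain. -/
theorem isHurwitz_and_hinfNorm_lt {γ : ℝ} (hγ : 0 < γ) {X : Matrix n n ℝ} (hX : X.PosDef)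
    (h : ∀ x w, (x ≠ 0 ∨ w ≠ 0) → perfForm A B C D γ X x w < 0) :
    IsHurwitz A ∧ hinfNorm (transferFunction A B C D) < ENNReal.ofReal γ := by
  obtain ⟨ε, hε, hdiss⟩ := exists_complex_dissipation hX h
  have hA : IsHurwitz A := by
    intro s hs
    by_contra! hre
    obtain ⟨x, hx, hAx⟩ := mem_spectrum_iff_exists_mulVec_eq.mp hs
    have h1 := hdiss s x 0 hre (by simp [hAx])
    have h2 := sum_norm_sq_pos hx
    simp only [mulVec_zero, add_zero, Pi.zero_apply, norm_zero, ne_eq, OfNat.ofNat_ne_zero,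
      not_false_eq_true, zero_pow, Finset.sum_const_zero, mul_zero, sub_zero] at h1
    have h3 : 0 ≤ γ⁻¹ * ∑ i, ‖(C.map Complex.ofReal *ᵥ x) i‖ ^ 2 := by positivity
    nlinarith
  refine ⟨hA, ?_⟩
  -- The dissipation estimate gives `|z|² ≤ γ (γ - ε) |w|²`; the maximum with `0` covers `ε > γ`.
  set c := Real.sqrt (max 0 (γ * (γ - ε))) with hc
  have hcγ : c < γ := by
    rw [hc, Real.sqrt_lt' hγ, max_lt_iff]
    constructor <;> nlinarith
  refine lt_of_le_of_lt (iSup₂_le fun s hs => ENNReal.ofReal_le_ofReal ?_)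
    ((ENNReal.ofReal_lt_ofReal_iff hγ).mpr hcγ)
  refine ContinuousLinearMap.opNorm_le_bound _ (Real.sqrt_nonneg _) fun w => ?_
  rw [← sq_le_sq₀ (norm_nonneg _) (by positivity), mul_pow, EuclideanSpace.norm_sq_eq,
    EuclideanSpace.norm_sq_eq, Real.sq_sqrt (le_max_left _ _)]
  have hdet := isUnit_det_smul_one_sub hA hs.le
  set x := (s • (1 : Matrix n n ℂ) - A.map Complex.ofReal)⁻¹ *ᵥ (B.map Complex.ofReal *ᵥ w.ofLp)
    with hx
  have hsx : s • x = A.map Complex.ofReal *ᵥ x + B.map Complex.ofReal *ᵥ w.ofLp := by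
    have h1 : (s • (1 : Matrix n n ℂ) - A.map Complex.ofReal) *ᵥ x
        = B.map Complex.ofReal *ᵥ w.ofLp := by
      rw [hx, mulVec_mulVec, mul_nonsing_inv _ hdet, one_mulVec]
    rw [← h1, sub_mulVec, smul_mulVec, one_mulVec, add_sub_cancel]
  have hG : transferFunction A B C D s *ᵥ w.ofLp
      = C.map Complex.ofReal *ᵥ x + D.map Complex.ofReal *ᵥ w.ofLp := by
    rw [transferFunction, add_mulVec, ← mulVec_mulVec, ← mulVec_mulVec]
  have h1 := hdiss s x w.ofLp hs.le hsx
  rw [← hG] at h1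
  change ∑ i, ‖(transferFunction A B C D s *ᵥ w.ofLp) i‖ ^ 2 ≤ _
  have h2 : 0 ≤ ∑ i, ‖x i‖ ^ 2 := by positivity
  have h3 : 0 ≤ ∑ i, ‖w.ofLp i‖ ^ 2 := by positivity
  have h4 : γ⁻¹ * ∑ i, ‖(transferFunction A B C D s *ᵥ w.ofLp) i‖ ^ 2
      ≤ (γ - ε) * ∑ i, ‖w.ofLp i‖ ^ 2 := by nlinarith
  rw [inv_mul_le_iff₀ hγ, ← mul_assoc] at h4
  exact h4.trans (mul_le_mul_of_nonneg_right (le_max_right _ _) h3)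

end Frequency

end BoundedReal

/-! ### Schur complement form of the bounded real inequality -/

section BlockLMI

variable {n m p : Type} [Fintype n] [Fintype m] [Fintype p] [DecidableEq m] [DecidableEq p]

/-- The block matrix of the bounded real lemma. -/
def boundedRealMatrix (A : Matrix n n ℝ) (B : Matrix n m ℝ) (C : Matrix p n ℝ) (D : Matrix p m ℝ)
    (γ : ℝ) (X : Matrix n n ℝ) : Matrix (n ⊕ (m ⊕ p)) (n ⊕ (m ⊕ p)) ℝ :=
  fromBlocks (X * A + Aᵀ * X) (fromCols (X * B) Cᵀ) (fromRows (Bᵀ * X) C)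
    (fromBlocks (-(γ • (1 : Matrix m m ℝ))) Dᵀ D (-(γ • (1 : Matrix p p ℝ))))

/-- Completion of the square in the auxiliary variable `z`. The square vanishes at `z = γ⁻¹ (C x + D
w)`, which gives one direction of `negDef_boundedRealMatrix_iff`; its sign gives the other. -/
lemma dotProduct_boundedRealMatrix (A : Matrix n n ℝ) (B : Matrix n m ℝ) (C : Matrix p n ℝ)
    (D : Matrix p m ℝ) {γ : ℝ} (hγ : γ ≠ 0) {X : Matrix n n ℝ} (hX : X.IsSymm)
    (x : n → ℝ) (w : m → ℝ) (z : p → ℝ) :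
    Sum.elim x (Sum.elim w z) ⬝ᵥ (boundedRealMatrix A B C D γ X *ᵥ Sum.elim x (Sum.elim w z))
      = perfForm A B C D γ X x w
        - γ * ((z - γ⁻¹ • (C *ᵥ x + D *ᵥ w)) ⬝ᵥ (z - γ⁻¹ • (C *ᵥ x + D *ᵥ w))) := by
  have h1 : ∀ {q r : Type} [Fintype q] [Fintype r] (M : Matrix r q ℝ) (u : q → ℝ) (v : r → ℝ),
      u ⬝ᵥ (Mᵀ *ᵥ v) = v ⬝ᵥ (M *ᵥ u) := fun M u v => by
    rw [dotProduct_mulVec, vecMul_transpose, dotProduct_comm]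
  have h2 : ∀ u v : n → ℝ, u ⬝ᵥ (X *ᵥ v) = v ⬝ᵥ (X *ᵥ u) := fun u v => by
    rw [dotProduct_mulVec, ← mulVec_transpose, hX.eq, dotProduct_comm]
  set y := C *ᵥ x + D *ᵥ w with hy
  have h3 : Sum.elim x (Sum.elim w z) ⬝ᵥ
      (boundedRealMatrix A B C D γ X *ᵥ Sum.elim x (Sum.elim w z))
      = 2 * (x ⬝ᵥ (X *ᵥ (A *ᵥ x + B *ᵥ w))) - γ * (w ⬝ᵥ w) + 2 * (z ⬝ᵥ y) - γ * (z ⬝ᵥ z) := by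
    simp only [boundedRealMatrix, fromBlocks_mulVec, Sum.elim_comp_inl, Sum.elim_comp_inr,
      sumElim_dotProduct_sumElim, add_mulVec, dotProduct_add, ← mulVec_mulVec,
      fromCols_mulVec, fromRows_mulVec, ← Sum.elim_add_add, h1, neg_mulVec, smul_mulVec,
      one_mulVec, dotProduct_neg, dotProduct_smul, smul_eq_mul, mulVec_add, hy]
    rw [dotProduct_comm (X *ᵥ x), dotProduct_comm (X *ᵥ x), h2 (A *ᵥ x) x, h2 (B *ᵥ w) x]
    ring
  rw [h3, perfForm]
  simp only [sub_dotProduct, dotProduct_sub, smul_dotProduct, dotProduct_smul, smul_eq_mul,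
    ← hy, dotProduct_comm y z]
  field_simp
  ring

omit [Fintype m] [Fintype p] in
lemma isSymm_boundedRealMatrix (A : Matrix n n ℝ) (B : Matrix n m ℝ) (C : Matrix p n ℝ)
    (D : Matrix p m ℝ) (γ : ℝ) {X : Matrix n n ℝ} (hX : X.IsSymm) :
    (boundedRealMatrix A B C D γ X).IsSymm := by
  simp [boundedRealMatrix, IsSymm, fromBlocks_transpose, transpose_mul, hX.eq, add_comm,
    transpose_fromCols, transpose_fromRows]

lemma negDef_boundedRealMatrix_iff (A : Matrix n n ℝ) (B : Matrix n m ℝ) (C : Matrix p n ℝ)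
    (D : Matrix p m ℝ) {γ : ℝ} (hγ : 0 < γ) {X : Matrix n n ℝ} (hX : X.IsSymm) :
    NegDef (boundedRealMatrix A B C D γ X) ↔
      ∀ x w, (x ≠ 0 ∨ w ≠ 0) → perfForm A B C D γ X x w < 0 := by
  have hherm : (-boundedRealMatrix A B C D γ X).IsHermitian := by
    rw [IsHermitian, conjTranspose_eq_transpose_of_trivial, transpose_neg,
      (isSymm_boundedRealMatrix A B C D γ hX).eq]
  constructor
  · intro h x w hxw
    have h1 := h.dotProduct_mulVec_pos
      (x := Sum.elim x (Sum.elim w (γ⁻¹ • (C *ᵥ x + D *ᵥ w)))) (fun h0 => by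
        rcases hxw with hx | hw
        · exact hx (by ext i; exact congrFun h0 (Sum.inl i))
        · exact hw (by ext i; exact congrFun h0 (Sum.inr (Sum.inl i))))
    rw [star_trivial, neg_mulVec, dotProduct_neg, dotProduct_boundedRealMatrix A B C D hγ.ne' hX,
      sub_self, zero_dotProduct, mul_zero] at h1
    linarith
  · intro h
    refine PosDef.of_dotProduct_mulVec_pos hherm fun v hv => ?_
    obtain ⟨x, w, z, rfl⟩ : ∃ x w z, v = Sum.elim x (Sum.elim w z) :=
      ⟨v ∘ Sum.inl, v ∘ Sum.inr ∘ Sum.inl, v ∘ Sum.inr ∘ Sum.inr, by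
        ext i
        rcases i with i | i | i <;> rfl⟩
    rw [star_trivial, neg_mulVec, dotProduct_neg, dotProduct_boundedRealMatrix A B C D hγ.ne' hX]
    have hsq : ∀ u : p → ℝ, 0 ≤ u ⬝ᵥ u := fun u => by
      simpa using dotProduct_star_self_nonneg u
    by_cases hxw : x ≠ 0 ∨ w ≠ 0
    · have h1 := h x w hxw
      have h2 := mul_nonneg hγ.le (hsq (z - γ⁻¹ • (C *ᵥ x + D *ᵥ w)))
      linarith
    · push Not at hxw
      obtain ⟨rfl, rfl⟩ := hxw
      have hz : z ≠ 0 := by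
        rintro rfl
        apply hv
        ext i
        rcases i with i | i | i <;> rfl
      have h1 : 0 < z ⬝ᵥ z := by
        have := dotProduct_star_self_pos_iff.mpr hz
        simpa using this
      simp only [perfForm, mulVec_zero, add_zero, dotProduct_zero, mul_zero, sub_zero, smul_zero,
        zero_sub, neg_neg]
      positivity

end BlockLMI

/-! ### The linearizing congruence -/

section ChangeOfVariables

variable {nx nu nw nz ny : ℕ}

/-- The congruence transformation `[X I; Mᵀ 0]`. -/
def congrT (X M : Matrix (Fin nx) (Fin nx) ℝ) : Matrix (Fin nx ⊕ Fin nx) (Fin nx ⊕ Fin nx) ℝ :=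
  fromBlocks X 1 Mᵀ 0

/-- The matrix `[I Y; 0 Nᵀ]`, which equals `Xcl [X I; Mᵀ 0]`. -/
def congrS (Y N : Matrix (Fin nx) (Fin nx) ℝ) : Matrix (Fin nx ⊕ Fin nx) (Fin nx ⊕ Fin nx) ℝ :=
  fromBlocks 1 Y 0 Nᵀ

lemma isUnit_congrT {X M : Matrix (Fin nx) (Fin nx) ℝ} (hM : IsUnit M) : IsUnit (congrT X M) := by
  have hdet := (isUnit_iff_isUnit_det _).mp ((isUnit_transpose M).mpr hM)
  refine IsUnit.of_mul_eq_one (fromBlocks 0 (Mᵀ)⁻¹ 1 (-(X * (Mᵀ)⁻¹))) ?_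
  rw [congrT, fromBlocks_multiply, ← fromBlocks_one]
  congr 1 <;> simp [mul_nonsing_inv _ hdet]

lemma transpose_congrT_mul_congrS (X Y M N : Matrix (Fin nx) (Fin nx) ℝ) :
    (congrT X M)ᵀ * congrS Y N = fromBlocks Xᵀ (Xᵀ * Y + M * Nᵀ) 1 Y := by
  simp [congrT, congrS, fromBlocks_transpose, fromBlocks_multiply]

variable {P : Plant nx nu nw nz ny} {K : Controller nx nu ny} {γ : ℝ}
  {X Y M N : Matrix (Fin nx) (Fin nx) ℝ}
  {Xcl : Matrix (Fin nx ⊕ Fin nx) (Fin nx ⊕ Fin nx) ℝ}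

/-- The product is symmetric along with `Xcl`. Comparing its explicit blocks with their transposes
forces `X` and `Y` to be symmetric and `Xᵀ Y + M Nᵀ = 1`, so none of these has to be assumed. -/
lemma transpose_congrT_mul_mul_congrT (hX : Xcl.IsSymm) (h : Xcl * congrT X M = congrS Y N) :
    (congrT X M)ᵀ * Xcl * congrT X M = fromBlocks X 1 1 Y ∧ Y.IsSymm := by
  have h1 : (congrT X M)ᵀ * Xcl * congrT X M = fromBlocks Xᵀ (Xᵀ * Y + M * Nᵀ) 1 Y := by
    rw [Matrix.mul_assoc, h, transpose_congrT_mul_congrS]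
  have h2 : ((congrT X M)ᵀ * Xcl * congrT X M)ᵀ = (congrT X M)ᵀ * Xcl * congrT X M := by
    simp [transpose_mul, hX.eq, Matrix.mul_assoc]
  have h3 := h2
  rw [h1, fromBlocks_transpose, fromBlocks_inj] at h3
  refine ⟨?_, h3.2.2.2⟩
  rw [h1, ← h3.2.1, ← h3.1]
  simp

/-- The origin of the change of variables: `Ĵ` collects the terms of this product that are nonlinear
in the controller and `X`, `Y`, `M`, `N`, leaving blocks affine in `(Ĵ, X, Y)`. -/
lemma transpose_congrS_mul_closedA_mul_congrT (hY : Y.IsSymm) :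
    (congrS Y N)ᵀ * closedA P K * congrT X M
      = fromBlocks (P.A * X + P.Bu * (changeVars P K X Y M N).Ch)
          (P.A + P.Bu * (changeVars P K X Y M N).Dh * P.Cy) (changeVars P K X Y M N).Ah
          (Y * P.A + (changeVars P K X Y M N).Bh * P.Cy) := by
  simp only [congrS, congrT, closedA, fromBlocks_transpose, fromBlocks_multiply, changeVars,
    transpose_one, transpose_zero, transpose_transpose, hY.eq]
  congr 1 <;>
    simp only [Matrix.mul_add, Matrix.add_mul, Matrix.mul_assoc, Matrix.one_mul, Matrix.mul_one,
      Matrix.zero_mul, Matrix.mul_zero, add_zero] <;> abel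

lemma transpose_congrS_mul_closedB (hY : Y.IsSymm) :
    (congrS Y N)ᵀ * closedB P K
      = fromRows (P.Bw + P.Bu * (changeVars P K X Y M N).Dh * P.Dyw)
          (Y * P.Bw + (changeVars P K X Y M N).Bh * P.Dyw) := by
  simp only [congrS, closedB, fromBlocks_transpose, changeVars, fromBlocks_mul_fromRows,
    transpose_one, transpose_zero, transpose_transpose, hY.eq]
  congr 1 <;>
    simp only [Matrix.mul_add, Matrix.add_mul, Matrix.mul_assoc, Matrix.one_mul,
      Matrix.zero_mul, add_zero]
  abel

lemma closedC_mul_congrT :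
    closedC P K * congrT X M
      = fromCols (P.Cz * X + P.Du * (changeVars P K X Y M N).Ch)
          (P.Cz + P.Du * (changeVars P K X Y M N).Dh * P.Cy) := by
  simp only [congrT, closedC, changeVars, fromCols_mul_fromBlocks]
  congr 1 <;>
    simp only [Matrix.mul_add, Matrix.add_mul, Matrix.mul_assoc, Matrix.mul_one,
      Matrix.mul_zero, add_zero]
  abel

/-- The output-feedback LMI is congruent to the bounded real LMI of the closed loop. -/
lemma hinfLMI_changeVars (hX : Xcl.IsSymm) (h : Xcl * congrT X M = congrS Y N) :
    hinfLMI P γ (changeVars P K X Y M N) X Y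
      = (fromBlocks (congrT X M) 0 0 (1 : Matrix (Fin nw ⊕ Fin nz) (Fin nw ⊕ Fin nz) ℝ))ᵀ
        * boundedRealMatrix (closedA P K) (closedB P K) (closedC P K) (closedD P K) γ Xcl
        * fromBlocks (congrT X M) 0 0 1 := by
  -- After the congruence `Xcl` occurs only through `Xcl T = S` and its transpose, so it disappears
  -- from every block.
  have hS : (congrT X M)ᵀ * Xcl = (congrS Y N)ᵀ := by
    rw [← h, transpose_mul, hX.eq]
  have hA : (congrT X M)ᵀ * (Xcl * closedA P K + (closedA P K)ᵀ * Xcl) * congrT X M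
      = (congrS Y N)ᵀ * closedA P K * congrT X M
        + ((congrS Y N)ᵀ * closedA P K * congrT X M)ᵀ := by
    rw [Matrix.mul_add, Matrix.add_mul, ← Matrix.mul_assoc, hS, transpose_mul, transpose_mul,
      transpose_transpose, ← h]
    simp only [Matrix.mul_assoc]
  have hB : (congrT X M)ᵀ * fromCols (Xcl * closedB P K) (closedC P K)ᵀ
      = fromCols ((congrS Y N)ᵀ * closedB P K) (closedC P K * congrT X M)ᵀ := by
    rw [mul_fromCols, ← Matrix.mul_assoc, hS, transpose_mul]
  have hC : fromRows ((closedB P K)ᵀ * Xcl) (closedC P K) * congrT X M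
      = fromRows ((congrS Y N)ᵀ * closedB P K)ᵀ (closedC P K * congrT X M) := by
    rw [fromRows_mul, Matrix.mul_assoc, h, transpose_mul, transpose_transpose]
  simp only [boundedRealMatrix, fromBlocks_transpose, fromBlocks_multiply, transpose_zero,
    transpose_one, Matrix.zero_mul, Matrix.mul_zero, Matrix.one_mul, Matrix.mul_one, add_zero,
    zero_add, hA, hB, hC]
  have hY := (transpose_congrT_mul_mul_congrT hX h).2
  rw [transpose_congrS_mul_closedA_mul_congrT hY, transpose_congrS_mul_closedB hY (X := X) (M := M),
    closedC_mul_congrT (Y := Y) (N := N), hinfLMI]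
  congr 1
  · rw [fromBlocks_transpose, fromBlocks_add, symPart, symPart]
    congr 1
    simp [add_comm]
  · ext i j
    rcases i with i | i <;> rcases j with j | j <;> rfl
  · ext i j
    rcases i with i | i <;> rcases j with j | j <;> rfl

/-- The LMI constraints for the transformed variables say that `Xcl` is a performance Lyapunov
matrix. -/
lemma changeVars_mem_lmiFeasible_iff (hγ : 0 < γ) (hX : Xcl.IsSymm) (hM : IsUnit M)
    (h : Xcl * congrT X M = congrS Y N) :
    (changeVars P K X Y M N, X, Y) ∈ lmiFeasible P γ ↔ IsPerfLyapunov P γ K Xcl := by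
  have hT := isUnit_congrT (X := X) hM
  have hT' : IsUnit (fromBlocks (congrT X M) 0 0
      (1 : Matrix (Fin nw ⊕ Fin nz) (Fin nw ⊕ Fin nz) ℝ)) :=
    isUnit_fromBlocks_zero₁₂.mpr ⟨hT, isUnit_one⟩
  have h1 : (fromBlocks X 1 1 Y).PosDef ↔ Xcl.PosDef := by
    rw [← (transpose_congrT_mul_mul_congrT hX h).1]
    exact hT.posDef_star_left_conjugate_iff
  have h2 : NegDef (hinfLMI P γ (changeVars P K X Y M N) X Y) ↔
      ∀ x w, (x ≠ 0 ∨ w ≠ 0) →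
        perfForm (closedA P K) (closedB P K) (closedC P K) (closedD P K) γ Xcl x w < 0 := by
    rw [← negDef_boundedRealMatrix_iff _ _ _ _ hγ hX, hinfLMI_changeVars hX h, NegDef, NegDef,
      ← Matrix.neg_mul, ← Matrix.mul_neg]
    exact hT'.posDef_star_left_conjugate_iff
  exact and_congr h1 h2

end ChangeOfVariables

/-! ### Blocks of the Lyapunov matrix, controller recovery and nonsingularity -/

section Blocks

variable {nx nu nw nz ny : ℕ}

lemma Matrix.PosDef.isSymm_real {n : Type*} [Fintype n] {X : Matrix n n ℝ} (hX : X.PosDef) :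
    X.IsSymm := by
  have := hX.isHermitian
  rwa [IsHermitian, conjTranspose_eq_transpose_of_trivial] at this

variable {Xcl : Matrix (Fin nx ⊕ Fin nx) (Fin nx ⊕ Fin nx) ℝ}

lemma eq_fromBlocks_of_isSymm {n m : Type*} {S : Matrix (n ⊕ m) (n ⊕ m) ℝ} (hS : S.IsSymm) :
    S = fromBlocks S.toBlocks₁₁ S.toBlocks₁₂ S.toBlocks₁₂ᵀ S.toBlocks₂₂ := by
  conv_lhs => rw [← fromBlocks_toBlocks S]
  congr 1
  ext i j
  exact hS.apply _ _

lemma eq_fromBlocks_blockY_blockN (hX : Xcl.PosDef) :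
    Xcl = fromBlocks (blockY Xcl) (blockN Xcl) (blockN Xcl)ᵀ Xcl.toBlocks₂₂ :=
  eq_fromBlocks_of_isSymm hX.isSymm_real

lemma inv_eq_fromBlocks_blockX_blockM (hX : Xcl.PosDef) :
    Xcl⁻¹ = fromBlocks (blockX Xcl) (blockM Xcl) (blockM Xcl)ᵀ Xcl⁻¹.toBlocks₂₂ :=
  eq_fromBlocks_of_isSymm hX.inv.isSymm_real

lemma fromBlocks_mul_fromBlocks_eq_one (hX : Xcl.PosDef) :
    fromBlocks (blockY Xcl) (blockN Xcl) (blockN Xcl)ᵀ Xcl.toBlocks₂₂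
      * fromBlocks (blockX Xcl) (blockM Xcl) (blockM Xcl)ᵀ Xcl⁻¹.toBlocks₂₂ = 1 := by
  rw [← eq_fromBlocks_blockY_blockN hX, ← inv_eq_fromBlocks_blockX_blockM hX]
  exact mul_nonsing_inv _ ((isUnit_iff_isUnit_det _).mp hX.isUnit)

lemma mul_congrT_eq_congrS (hX : Xcl.PosDef) :
    Xcl * congrT (blockX Xcl) (blockM Xcl) = congrS (blockY Xcl) (blockN Xcl) := by
  have h := fromBlocks_mul_fromBlocks_eq_one hX
  rw [fromBlocks_multiply, ← fromBlocks_one, fromBlocks_inj] at h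
  calc Xcl * congrT (blockX Xcl) (blockM Xcl)
      = fromBlocks (blockY Xcl) (blockN Xcl) (blockN Xcl)ᵀ Xcl.toBlocks₂₂
        * congrT (blockX Xcl) (blockM Xcl) :=
      congrArg (· * congrT (blockX Xcl) (blockM Xcl)) (eq_fromBlocks_blockY_blockN hX)
    _ = congrS (blockY Xcl) (blockN Xcl) := by
      rw [congrT, congrS, fromBlocks_multiply, h.1, h.2.2.1]
      simp

/-- The upper right block of `Xcl Xcl⁻¹ = 1` reads `Y M + N Z = 0`, where `Y` and `Z` are
nonsingular as principal blocks of positive definite matrices. Hence only `N` has to be made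
nonsingular by perturbation. -/
lemma isUnit_blockM (hX : Xcl.PosDef) (hN : IsUnit (blockN Xcl)) : IsUnit (blockM Xcl) := by
  have h := fromBlocks_mul_fromBlocks_eq_one hX
  rw [fromBlocks_multiply, ← fromBlocks_one, fromBlocks_inj] at h
  have hY : IsUnit (blockY Xcl) := (hX.submatrix Sum.inl_injective).isUnit
  have hZ : IsUnit Xcl⁻¹.toBlocks₂₂ := (hX.inv.submatrix Sum.inr_injective).isUnit
  have h1 : blockY Xcl * blockM Xcl = -(blockN Xcl * Xcl⁻¹.toBlocks₂₂) :=
    eq_neg_of_add_eq_zero_left h.2.1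
  have h2 : IsUnit (blockY Xcl * blockM Xcl) := h1 ▸ (hN.mul hZ).neg
  rw [isUnit_iff_isUnit_det, det_mul, IsUnit.mul_iff] at h2
  exact (isUnit_iff_isUnit_det _).mpr h2.2

/-- A positive definite matrix with prescribed blocks in it and in its inverse. -/
lemma exists_posDef_of_blocks {X Y M N : Matrix (Fin nx) (Fin nx) ℝ}
    (hΦ : (fromBlocks X 1 1 Y).PosDef) (hM : IsUnit M) (hMN : M * Nᵀ = 1 - X * Y) :
    ∃ Xcl : Matrix (Fin nx ⊕ Fin nx) (Fin nx ⊕ Fin nx) ℝ, Xcl.PosDef ∧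
      blockX Xcl = X ∧ blockY Xcl = Y ∧ blockM Xcl = M ∧ blockN Xcl = N := by
  have hT := isUnit_congrT (X := X) hM
  have hTdet := (isUnit_iff_isUnit_det _).mp hT
  have hXs : Xᵀ = X := (isSymm_fromBlocks_iff.mp hΦ.isSymm_real).1
  have hTS : (congrT X M)ᵀ * congrS Y N = fromBlocks X 1 1 Y := by
    rw [transpose_congrT_mul_congrS, hXs, hMN, add_sub_cancel]
  -- The only candidate satisfying `Xcl T = S`; it is congruent to `[X I; I Y]` through `T`.
  set Xcl := congrS Y N * (congrT X M)⁻¹ with hXcl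
  have hmul : Xcl * congrT X M = congrS Y N := by
    rw [hXcl, Matrix.mul_assoc, nonsing_inv_mul _ hTdet, Matrix.mul_one]
  have hpd : Xcl.PosDef := by
    rw [← hT.posDef_star_left_conjugate_iff, star_eq_conjTranspose,
      conjTranspose_eq_transpose_of_trivial, Matrix.mul_assoc, hmul, hTS]
    exact hΦ
  have hinv : Xcl⁻¹ * congrS Y N = congrT X M := by
    rw [← hmul, ← Matrix.mul_assoc,
      nonsing_inv_mul _ ((isUnit_iff_isUnit_det _).mp hpd.isUnit), Matrix.one_mul]
  rw [eq_fromBlocks_blockY_blockN hpd, congrT, congrS, fromBlocks_multiply, fromBlocks_inj] at hmul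
  rw [inv_eq_fromBlocks_blockX_blockM hpd, congrT, congrS, fromBlocks_multiply,
    fromBlocks_inj] at hinv
  refine ⟨Xcl, hpd, ?_, ?_, ?_, ?_⟩
  · simpa using hinv.1
  · simpa using hmul.2.1
  · exact transpose_injective (by simpa using hinv.2.2.1)
  · exact transpose_injective (by simpa using hmul.2.2.2)

/-- If `X Y v = v`, then `(Y v, -v)` lies in the kernel of `[X I; I Y]`. -/
lemma isUnit_one_sub_mul {X Y : Matrix (Fin nx) (Fin nx) ℝ} (hΦ : (fromBlocks X 1 1 Y).PosDef) :
    IsUnit (1 - X * Y) := by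
  rw [isUnit_iff_isUnit_det, isUnit_iff_ne_zero]
  intro h0
  obtain ⟨v, hv, hv0⟩ := exists_mulVec_eq_zero_iff.mpr h0
  have h1 : fromBlocks X 1 1 Y *ᵥ Sum.elim (Y *ᵥ v) (-v) = 0 := by
    rw [sub_mulVec, one_mulVec, sub_eq_zero, ← mulVec_mulVec] at hv0
    rw [fromBlocks_mulVec]
    simp only [Sum.elim_comp_inl, Sum.elim_comp_inr, ← hv0, one_mulVec, add_neg_cancel, mulVec_neg]
    ext i
    cases i <;> rfl
  have h2 := hΦ.dotProduct_mulVec_pos (x := Sum.elim (Y *ᵥ v) (-v)) (fun h => hv (by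
    ext i
    simpa using congrFun h (Sum.inr i)))
  rw [h1, dotProduct_zero] at h2
  exact lt_irrefl _ h2

variable {P : Plant nx nu nw nz ny} {γ : ℝ}

lemma changeVars_constructController (J : HatVars nx nu ny) (X Y : Matrix (Fin nx) (Fin nx) ℝ)
    {M N : Matrix (Fin nx) (Fin nx) ℝ} (hM : IsUnit M) (hN : IsUnit N) :
    changeVars P (constructController P J X Y M N) X Y M N = J := by
  have hMd := (isUnit_iff_isUnit_det _).mp ((isUnit_transpose M).mpr hM)
  have hNd := (isUnit_iff_isUnit_det _).mp hN
  have h1 : ∀ {q : Type} (Q : Matrix q (Fin nx) ℝ), Q * (Mᵀ)⁻¹ * Mᵀ = Q := fun Q =>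
    nonsing_inv_mul_cancel_right _ Q hMd
  have h2 : ∀ {q : Type} (Q : Matrix (Fin nx) q ℝ), N * (N⁻¹ * Q) = Q := fun Q =>
    mul_nonsing_inv_cancel_left _ Q hNd
  have h3 : ∀ Q : Matrix (Fin nx) (Fin nx) ℝ, N * (N⁻¹ * Q * (Mᵀ)⁻¹) * Mᵀ = Q := fun Q => by
    rw [Matrix.mul_assoc N⁻¹, h2, h1]
  refine HatVars.ext ?_ ?_ ?_ rfl
  · simp only [changeVars, constructController, h3]
    abel
  · simp only [changeVars, constructController, h2]
    abel
  · simp only [changeVars, constructController, h1]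
    abel

lemma meetsSpec_iff_exists_isPerfLyapunov {nk : ℕ} (hγ : 0 < γ) (K : Controller nk nu ny) :
    MeetsSpec P γ K ↔ ∃ Xcl, IsPerfLyapunov P γ K Xcl :=
  ⟨fun h => exists_posDef_perfForm_neg hγ h.1 h.2,
    fun ⟨_, h⟩ => isHurwitz_and_hinfNorm_lt hγ h.1 h.2⟩

lemma isNegForm_neg_iff_posDef {n : Type*} [Fintype n] {S : Matrix n n ℝ} (hS : S.IsSymm) :
    IsNegForm (-S) ↔ S.PosDef := by
  rw [posDef_iff_dotProduct_mulVec, IsHermitian, conjTranspose_eq_transpose_of_trivial]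
  simp [IsNegForm, hS.eq, neg_mulVec]

/-- A performance Lyapunov matrix can be perturbed so that its off-diagonal block is nonsingular. -/
lemma exists_isPerfLyapunov_isUnit_blockN {K : Controller nx nu ny}
    (h : IsPerfLyapunov P γ K Xcl) :
    ∃ Xcl', IsPerfLyapunov P γ K Xcl' ∧ IsUnit (blockN Xcl') := by
  -- Adding `t • E` shifts the off-diagonal block to `N + t I`. Both inequalities are open
  -- conditions at `t = 0`, while `N + t I` is singular only for the finitely many `t` in the
  -- spectrum of `-N`.
  let E : Matrix (Fin nx ⊕ Fin nx) (Fin nx ⊕ Fin nx) ℝ := fromBlocks 0 1 1 0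
  let S : ℝ → Matrix (Fin nx ⊕ Fin nx) (Fin nx ⊕ Fin nx) ℝ := fun t => Xcl + t • E
  have hS : ∀ t, (S t).IsSymm := fun t => by
    have hE : E.IsSymm := by simp [E, IsSymm, fromBlocks_transpose]
    rw [IsSymm, transpose_add, transpose_smul, h.1.isSymm_real.eq, hE.eq]
  have hSc : Continuous S := by fun_prop
  have hS0 : S 0 = Xcl := by simp [S]
  have h1 : ∀ᶠ t in nhds (0 : ℝ), IsNegForm (-S t) :=
    hSc.neg.continuousAt.eventually_mem
      (isOpen_isNegForm.mem_nhds (by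
        rw [Pi.neg_apply, hS0]
        exact (isNegForm_neg_iff_posDef h.1.isSymm_real).mpr h.1))
  have h2 : ∀ᶠ t in nhds (0 : ℝ), IsNegForm (supplyMatrix (closedC P K) (closedD P K) γ
      + lyapMatrix (closedA P K) (closedB P K) (S t)) := by
    have hc : Continuous fun t => supplyMatrix (closedC P K) (closedD P K) γ
        + lyapMatrix (closedA P K) (closedB P K) (S t) := by
      unfold lyapMatrix
      exact continuous_const.add (((hSc.matrix_mul continuous_const).add
        (continuous_const.matrix_mul hSc)).matrix_fromBlocks (hSc.matrix_mul continuous_const)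
        (continuous_const.matrix_mul hSc) continuous_const)
    refine hc.continuousAt.eventually_mem (isOpen_isNegForm.mem_nhds ?_)
    rw [hS0]
    exact (isNegForm_supply_add_lyap_iff _ _ _ _ _ h.1.isSymm_real).mpr h.2
  have h3 : ∃ᶠ t in nhds (0 : ℝ), t ∉ spectrum ℝ (-blockN Xcl) := by
    have hfin : (spectrum ℝ (-blockN Xcl)).Finite := Matrix.finite_spectrum _
    exact mem_closure_iff_frequently.mp (hfin.countable.dense_compl ℝ 0)
  obtain ⟨t, ht3, ht1, ht2⟩ := (h3.and_eventually (h1.and h2)).exists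
  refine ⟨S t, ⟨(isNegForm_neg_iff_posDef (hS t)).mp ht1,
    (isNegForm_supply_add_lyap_iff _ _ _ _ _ (hS t)).mp ht2⟩, ?_⟩
  have h4 := spectrum.notMem_iff.mp ht3
  rw [Algebra.algebraMap_eq_smul_one, sub_neg_eq_add] at h4
  have h5 : blockN (S t) = t • 1 + blockN Xcl := by
    ext i j
    simp [blockN, S, E, toBlocks₁₂, add_comm]
  rwa [h5]

lemma hatOf_mem_lmiFeasible_iff (hγ : 0 < γ) (K : Controller nx nu ny) (hX : Xcl.PosDef)
    (hM : IsUnit (blockM Xcl)) :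
    (hatOf P K Xcl, blockX Xcl, blockY Xcl) ∈ lmiFeasible P γ ↔ IsPerfLyapunov P γ K Xcl :=
  changeVars_mem_lmiFeasible_iff hγ hX.isSymm_real hM (mul_congrT_eq_congrS hX)

lemma meetsSpec_iff_exists_hatOf_mem_lmiFeasible (hγ : 0 < γ) (K : Controller nx nu ny) :
    MeetsSpec P γ K ↔
      ∃ Xcl : Matrix (Fin nx ⊕ Fin nx) (Fin nx ⊕ Fin nx) ℝ, Xcl.PosDef ∧
        IsUnit (blockM Xcl) ∧ IsUnit (blockN Xcl) ∧
        (hatOf P K Xcl, blockX Xcl, blockY Xcl) ∈ lmiFeasible P γ := by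
  rw [meetsSpec_iff_exists_isPerfLyapunov hγ]
  constructor
  · rintro ⟨Xcl, h⟩
    obtain ⟨Xcl', h', hN⟩ := exists_isPerfLyapunov_isUnit_blockN h
    have hM := isUnit_blockM h'.1 hN
    exact ⟨Xcl', h'.1, hM, hN, (hatOf_mem_lmiFeasible_iff hγ K h'.1 hM).mpr h'⟩
  · rintro ⟨Xcl, hX, hM, -, h⟩
    exact ⟨Xcl, (hatOf_mem_lmiFeasible_iff hγ K hX hM).mp h⟩

lemma exists_isRepresentation_constructController (hγ : 0 < γ) {J : HatVars nx nu ny}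
    {X Y : Matrix (Fin nx) (Fin nx) ℝ} (h : (J, X, Y) ∈ lmiFeasible P γ)
    {M N : Matrix (Fin nx) (Fin nx) ℝ} (hMN : M * Nᵀ = 1 - X * Y) :
    ∃ Xcl, IsRepresentation P γ (constructController P J X Y M N) Xcl J ∧
      blockX Xcl = X ∧ blockY Xcl = Y ∧ blockM Xcl = M ∧ blockN Xcl = N := by
  have hΦ : (fromBlocks X 1 1 Y).PosDef := h.1
  have hu := isUnit_one_sub_mul hΦ
  -- Both factors of the nonsingular matrix `1 - X Y` are nonsingular.
  rw [← hMN, isUnit_iff_isUnit_det, det_mul, det_transpose, IsUnit.mul_iff,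
    ← isUnit_iff_isUnit_det, ← isUnit_iff_isUnit_det] at hu
  obtain ⟨Xcl, hpd, rfl, rfl, rfl, rfl⟩ := exists_posDef_of_blocks hΦ hu.1 hMN
  have hJ : J = hatOf P (constructController P J (blockX Xcl) (blockY Xcl) (blockM Xcl)
      (blockN Xcl)) Xcl := (changeVars_constructController J _ _ hu.1 hu.2).symm
  have hperf : IsPerfLyapunov P γ (constructController P J (blockX Xcl) (blockY Xcl) (blockM Xcl)
      (blockN Xcl)) Xcl := by
    rw [← hatOf_mem_lmiFeasible_iff hγ _ hpd hu.1, ← hJ]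
    exact h
  exact ⟨Xcl, ⟨(meetsSpec_iff_exists_isPerfLyapunov hγ _).mpr ⟨Xcl, hperf⟩, hperf, hu.1, hu.2, hJ⟩,
    rfl, rfl, rfl, rfl⟩

lemma mem_lmiFeasible_iff_exists_isRepresentation (hγ : 0 < γ) (J : HatVars nx nu ny)
    (X Y : Matrix (Fin nx) (Fin nx) ℝ) :
    (J, X, Y) ∈ lmiFeasible P γ ↔
      ∃ K Xcl, IsRepresentation P γ K Xcl J ∧ blockX Xcl = X ∧ blockY Xcl = Y := by
  constructor
  · intro h
    -- Any factorization serves here; the trivial one has `M = 1 - X Y` and `N = 1`.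
    obtain ⟨Xcl, hrep, hX, hY, -⟩ := exists_isRepresentation_constructController hγ h
      (M := 1 - X * Y) (N := 1) (by rw [transpose_one, Matrix.mul_one])
    exact ⟨_, Xcl, hrep, hX, hY⟩
  · rintro ⟨K, Xcl, ⟨-, hperf, hM, -, rfl⟩, rfl, rfl⟩
    exact (hatOf_mem_lmiFeasible_iff hγ K hperf.1 hM).mpr hperf

/-- The design feasible set is a projection of the LMI feasible set; as the cost ignores `X` and
`Y`, infima and minimizers correspond. -/
lemma mem_designFeasible_iff (hγ : 0 < γ) (J : HatVars nx nu ny) :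
    J ∈ designFeasible P γ ↔ ∃ X Y, (J, X, Y) ∈ lmiFeasible P γ := by
  simp only [mem_lmiFeasible_iff_exists_isRepresentation hγ]
  exact ⟨fun ⟨K, Xcl, h⟩ => ⟨_, _, K, Xcl, h, rfl, rfl⟩, fun ⟨_, _, K, Xcl, h, _⟩ => ⟨K, Xcl, h⟩⟩

end Blocks

/-! ### The equivalence of the two problems -/

theorem theorem6 {nx nu nw nz ny : ℕ} (P : Plant nx nu nw nz ny)
    (μ : Fin nu → ℝ) (ν : Fin ny → ℝ) (hμ : ∀ i, 0 ≤ μ i) (hν : ∀ i, 0 ≤ ν i)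
    (γ : ℝ) (hγ : 0 < γ) :
    -- a controller meets the specification iff its transformed variables satisfy the LMI
    (∀ K : Controller nx nu ny, MeetsSpec P γ K ↔
      ∃ Xcl : Matrix (Fin nx ⊕ Fin nx) (Fin nx ⊕ Fin nx) ℝ, Xcl.PosDef ∧
        IsUnit (blockM Xcl) ∧ IsUnit (blockN Xcl) ∧
        (hatOf P K Xcl, blockX Xcl, blockY Xcl) ∈ lmiFeasible P γ) ∧
    -- the feasible points of the two problems correspond to each other
    (∀ (J : HatVars nx nu ny) (X Y : Matrix (Fin nx) (Fin nx) ℝ),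
      (J, X, Y) ∈ lmiFeasible P γ ↔
        ∃ K Xcl, IsRepresentation P γ K Xcl J ∧ blockX Xcl = X ∧ blockY Xcl = Y) ∧
    -- recovery of the controller from a feasible point of the LMI program
    (∀ (J : HatVars nx nu ny) (X Y : Matrix (Fin nx) (Fin nx) ℝ),
      (J, X, Y) ∈ lmiFeasible P γ →
        IsUnit (1 - X * Y) ∧
        ∀ M N : Matrix (Fin nx) (Fin nx) ℝ, M * Nᵀ = 1 - X * Y →
          ∃ Xcl, IsRepresentation P γ (constructController P J X Y M N) Xcl J ∧
            blockX Xcl = X ∧ blockY Xcl = Y ∧ blockM Xcl = M ∧ blockN Xcl = N) ∧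
    -- equal optimal values
    optValue (sparsityCost μ ν) (designFeasible P γ) =
      optValue (fun t => sparsityCost μ ν t.1) (lmiFeasible P γ) ∧
    -- same optimal solutions
    (∀ J : HatVars nx nu ny, IsOptimal (sparsityCost μ ν) (designFeasible P γ) J ↔
      ∃ X Y : Matrix (Fin nx) (Fin nx) ℝ,
        IsOptimal (fun t => sparsityCost μ ν t.1) (lmiFeasible P γ) (J, X, Y)) := by
  refine ⟨meetsSpec_iff_exists_hatOf_mem_lmiFeasible hγ,
    mem_lmiFeasible_iff_exists_isRepresentation hγ,
    fun J X Y h => ⟨isUnit_one_sub_mul h.1, fun M N hMN =>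
      exists_isRepresentation_constructController hγ h hMN⟩, ?_, fun J => ?_⟩
  · refine le_antisymm (le_iInf₂ fun t ht => ?_) (le_iInf₂ fun J hJ => ?_)
    · exact iInf₂_le t.1 ((mem_designFeasible_iff hγ t.1).mpr ⟨t.2.1, t.2.2, ht⟩)
    · obtain ⟨X, Y, h⟩ := (mem_designFeasible_iff hγ J).mp hJ
      exact iInf₂_le (J, X, Y) h
  · constructor
    · rintro ⟨hJ, hmin⟩
      obtain ⟨X, Y, h⟩ := (mem_designFeasible_iff hγ J).mp hJ
      exact ⟨X, Y, h, fun t ht =>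
        hmin t.1 ((mem_designFeasible_iff hγ t.1).mpr ⟨t.2.1, t.2.2, ht⟩)⟩
    · rintro ⟨X, Y, h, hmin⟩
      refine ⟨(mem_designFeasible_iff hγ J).mpr ⟨X, Y, h⟩, fun J' hJ' => ?_⟩
      obtain ⟨X', Y', h'⟩ := (mem_designFeasible_iff hγ J').mp hJ'
      exact hmin (J', X', Y') h'
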